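/- Let $M$ be a compact smooth manifold with smooth boundary, $g$ a smooth Riemannian metric, $\alpha$ a smooth $1$-form and $U$ a smooth function on $M$, and let $k>\max_M U$. Let $Y$ be the Lorentz force of $\Omega=d\alpha$, i.e. $\Omega_x(u,w)=(Y_xu,w)_g$. An $\mathcal{MP}$-geodesic of $(g,\alpha,U)$ is a $C^2$ curve in $M$ with $\nabla_{\dot\sigma}\dot\sigma=Y(\dot\sigma)-\nabla U(\sigma)$. For $(x,v)\in TM$ let $\sigma$ be the $\mathcal{MP}$-geodesic with $\sigma(0)=x$, $\dot\sigma(0)=v$, and let the exit time $\tau(x,v)\in[0,\infty]$ be the supremum of the times up to which it stays in $M$ (it is finite on simple systems). Let $S^kM=\{(x,v)\in TM:\tfrac12|v|_g^2+U(x)=k\}$ and $\partial_+S^kM=\{(x,v)\in S^kM: x\in\partial M,\ (v,\nu(x))_g\ge 0\}$, with $\nu$ the inward unit normal. For a square integrable triple $\mathbf f=[h,\beta,V]$ (a symmetric $2$-tensor field, a $1$-form and a function, given by everywhere defined representatives, with $\int_M(|h|_g^2+|\beta|_g^2+|V|^2)\,d\mathrm{vol}_g<\infty$) the $\mathcal{MP}$-ray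 transform is $$I\mathbf f(x,v)=\int_0^{\tau(x,v)}\bigl\{h_{ij}(\sigma)\dot\sigma^i\dot\sigma^j+\beta_i(\sigma)\dot\sigma^i+V(\sigma)\bigr\}\,dt .$$ The reduced magnetic system is $(G,\alpha)$ with $G=2(k-U)g$ and energy $\tfrac12$. Its magnetic geodesics and its exit time $\tau_G$ are defined as above with $g$ replaced by $G$ and $U$ by $0$; $\partial_+S^GM$ is the set of $G$-unit vectors $w$ at points of $\partial M$ with $(w,\nu_G)_G\ge0$, where $\nu_G$ is the inward $G$-unit normal; and, with $\gamma$ the magnetic geodesic with $\gamma(0)=x$, $\dot\gamma(0)=w$, $$I_{\mathcal M}[h,\beta](x,w)=\int_0^{\tau_G(x,w)}\bigl\{h_{ij}(\gamma)\dot\gamma^i\dot\gamma^j+\beta_i(\gamma)\dot\gamma^i\bigr\}\,ds .$$ Put $\Phi[h,\beta,V]=[2(k-U)h+gV,\ \beta]$. Then for every square integrable triple $\mathbf f$ the pair $\Phi(\mathbf f)$ is square integrable with respect to $G$, and for every $(x,v)\in\partial_+S^kM$ one has $\bigl(x,\tfrac{v}{2(k-U(x))}\bigr)\in\partial_+S^GM$,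 the integral defining $I\mathbf f(x,v)$ converges absolutely if and only if the one defining $I_{\mathcal M}\Phi(\mathbf f)\bigl(x,\tfrac{v}{2(k-U(x))}\bigr)$ does, and $$I\mathbf f(x,v)=I_{\mathcal M}\Phi(\mathbf f)\Bigl(x,\frac{v}{2(k-U(x))}\Bigr)$$ (where an integral that does not converge absolutely is given the value $0$). -/

import Mathlib

open Set MeasureTheory Bundle
open scoped Manifold ContDiff ENNReal

noncomputable section

set_option synthInstance.maxHeartbeats 400000
set_option maxHeartbeats 1000000

namespace MPRay

/-- The model space `ℝⁿ`. -/
abbrev E (n : ℕ) := EuclideanSpace ℝ (Fin n)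

/-- The tangent space at `x` of a manifold with boundary modelled on the half space
`{y ∈ ℝⁿ : 0 ≤ y⁰}`. -/
abbrev TSp (n : ℕ) [NeZero n] {M : Type*} [TopologicalSpace M]
    [ChartedSpace (EuclideanHalfSpace n) M] (x : M) := TangentSpace (𝓡∂ n) x

/-- The tangent bundle `TM`. -/
abbrev TM (n : ℕ) [NeZero n] (M : Type*) [TopologicalSpace M]
    [ChartedSpace (EuclideanHalfSpace n) M] := TangentBundle (𝓡∂ n) M

section Metrics

variable (n : ℕ) [NeZero n] (M : Type*) [TopologicalSpace M]
  [ChartedSpace (EuclideanHalfSpace n) M] [IsManifold (𝓡∂ n) ∞ M]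

/-- Smooth Riemannian metrics on `M`. -/
abbrev Metric := ContMDiffRiemannianMetric (𝓡∂ n) ∞ (E n) (fun x : M => TSp n x)

/-- Smooth `1`-forms on `M`. -/
structure OneForm where
  toFun : ∀ x : M, TSp n x →L[ℝ] ℝ
  contMDiff : ContMDiff (𝓡∂ n) ((𝓡∂ n).prod 𝓘(ℝ, E n →L[ℝ] ℝ)) ∞
    (fun x => TotalSpace.mk' (E n →L[ℝ] ℝ) (E := fun x : M => TSp n x →L[ℝ] ℝ) x (toFun x))

/-- An MP-system `(g, α, U)` on `M`: a Riemannian metric, a magnetic potential (the magnetic field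
is `Ω = dα`) and a potential. -/
structure MPSystem where
  g : Metric n M
  α : OneForm n M
  U : M → ℝ
  contMDiff_U : ContMDiff (𝓡∂ n) 𝓘(ℝ, ℝ) ∞ U

/-- A magnetic system `(G, α)` on `M`. -/
structure MagneticSystem where
  G : Metric n M
  α : OneForm n M

/-- Triples `[h, β, V]`: a symmetric `2`-tensor field, a `1`-form and a function, with no
regularity. -/
structure Triple where
  h : ∀ x : M, TSp n x →L[ℝ] TSp n x →L[ℝ] ℝ
  h_symm : ∀ x u w, h x u w = h x w u
  β : ∀ x : M, TSp n x →L[ℝ] ℝ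
  V : M → ℝ

/-- Pairs `[h, β]`: a symmetric `2`-tensor field and a `1`-form, with no regularity. -/
structure Pair where
  h : ∀ x : M, TSp n x →L[ℝ] TSp n x →L[ℝ] ℝ
  h_symm : ∀ x u w, h x u w = h x w u
  β : ∀ x : M, TSp n x →L[ℝ] ℝ

end Metrics

variable {n : ℕ} [NeZero n] {M : Type*} [TopologicalSpace M]
  [ChartedSpace (EuclideanHalfSpace n) M] [IsManifold (𝓡∂ n) ∞ M]

/-! ### Local coordinates -/

/-- The point of `M` with coordinates `y` in the chart at `x₀`. -/
def pt (x₀ : M) (y : E n) : M := (extChartAt (𝓡∂ n) x₀).symm y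

/-- The coordinate frame at `x` of the chart at `x₀`: `u ↦ uⁱ ∂ᵢ|ₓ`. -/
def frame (x₀ x : M) : E n →L[ℝ] TSp n x :=
  (trivializationAt (E n) (fun x : M => TSp n x) x₀).symmL ℝ x

/-- The components `g_{ij}` of a metric in the chart at `x₀`. -/
def metricInChart (g : Metric n M) (x₀ : M) (y : E n) : E n →L[ℝ] E n →L[ℝ] ℝ :=
  ((frame x₀ (pt x₀ y)).precomp ℝ).comp ((g.inner (pt x₀ y)).comp (frame x₀ (pt x₀ y)))

/-- The components `α_i` of a `1`-form in the chart at `x₀`. -/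
def oneFormInChart (α : OneForm n M) (x₀ : M) (y : E n) : E n →L[ℝ] ℝ :=
  (α.toFun (pt x₀ y)).comp (frame x₀ (pt x₀ y))

/-- The Christoffel symbols at `y` of a field of scalar products `B = (g_{ij})` on a subset `s` of a
vector space: `Γ(u, w)ᵏ = ½ gᵏˡ (∂ᵢ g_{jl} + ∂ⱼ g_{il} - ∂ₗ g_{ij}) uⁱ wʲ`. -/
def christoffelOf {F : Type*} [NormedAddCommGroup F] [NormedSpace ℝ F]
    (B : F → F →L[ℝ] F →L[ℝ] ℝ) (s : Set F) (y u w : F) : F :=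
  let D : F →L[ℝ] F →L[ℝ] F →L[ℝ] ℝ := fderivWithin ℝ B s y
  (B y).inverse ((1 / 2 : ℝ) • (D u w + D w u - (D.flip u).flip w))

/-- The Christoffel symbols of the Levi-Civita connection of `g` in the chart at `x₀`. -/
def christoffel (g : Metric n M) (x₀ : M) (y u w : E n) : E n :=
  christoffelOf (metricInChart g x₀) (range (𝓡∂ n)) y u w

/-- The magnetic field `Ω = dα` in the chart at `x₀`:
`Ω(u, w) = (∂ᵢ αⱼ - ∂ⱼ αᵢ) uⁱ wʲ`. -/
def magneticField (α : OneForm n M) (x₀ : M) (y : E n) : E n →L[ℝ] E n →L[ℝ] ℝ :=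
  let D : E n →L[ℝ] E n →L[ℝ] ℝ := fderivWithin ℝ (oneFormInChart α x₀) (range (𝓡∂ n)) y
  D - D.flip

/-- The Lorentz force `Y` in the chart at `x₀`: `Ω(u, w) = (Y u, w)_g`. -/
def lorentzForce (g : Metric n M) (α : OneForm n M) (x₀ : M) (y u : E n) : E n :=
  (metricInChart g x₀ y).inverse (magneticField α x₀ y u)

/-- The Riemannian gradient of `U` in the chart at `x₀`: `(∇U)ᵏ = gᵏˡ ∂ₗ U`. -/
def gradient (g : Metric n M) (U : M → ℝ) (x₀ : M) (y : E n) : E n :=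
  (metricInChart g x₀ y).inverse
    (fderivWithin ℝ (fun z : E n => U (pt x₀ z)) (range (𝓡∂ n)) y)

/-! ### MP-geodesics, the MP-flow and the exit time -/

/-- `σ : [0, T] → M` is an MP-geodesic: a `C²` curve with `∇_σ̇ σ̇ = Y(σ̇) - ∇U(σ)`, written out in
all the charts `chartAt x₀`. -/
def MPSystem.IsGeodesic (S : MPSystem n M) (σ : ℝ → M) (T : ℝ) : Prop :=
  0 < T ∧ ContMDiffOn 𝓘(ℝ, ℝ) (𝓡∂ n) 2 σ (Icc 0 T) ∧
  ∀ x₀ : M, ∀ t ∈ Icc 0 T, σ t ∈ (chartAt (EuclideanHalfSpace n) x₀).source →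
    let y : ℝ → E n := fun s => extChartAt (𝓡∂ n) x₀ (σ s)
    let y' : ℝ → E n := derivWithin y (Icc 0 T)
    derivWithin y' (Icc 0 T) t + christoffel S.g x₀ (y t) (y' t) (y' t)
      = lorentzForce S.g S.α x₀ (y t) (y' t) - gradient S.g S.U x₀ (y t)

/-- The phase curve `t ↦ (σ(t), σ̇(t))` of a curve on `[0, T]`. -/
def phase (σ : ℝ → M) (T t : ℝ) : TM n M :=
  ⟨σ t, mfderivWithin 𝓘(ℝ, ℝ) (𝓡∂ n) σ (Icc 0 T) t (1 : ℝ)⟩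

/-- `σ : [0, T] → M` is an MP-geodesic with initial position and velocity `p`. -/
def MPSystem.IsGeodesicFrom (S : MPSystem n M) (p : TM n M) (σ : ℝ → M) (T : ℝ) : Prop :=
  S.IsGeodesic σ T ∧ phase σ T 0 = p

/-- The exit time `τ(x, v) ∈ [0, ∞]`: the supremum of the times up to which the MP-geodesic
starting from `(x, v)` stays in `M` (it is `0` if the geodesic leaves `M` at once). -/
def MPSystem.exitTime (S : MPSystem n M) (p : TM n M) : ℝ≥0∞ :=
  sSup {r | ∃ (T : ℝ) (σ : ℝ → M), S.IsGeodesicFrom p σ T ∧ r = ENNReal.ofReal T}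

open Classical in
/-- The MP-flow `φ_t(x, v) = (σ(t), σ̇(t))`, where `σ` is the MP-geodesic starting from `(x, v)`
(with the value `(x, v)` if this geodesic does not exist up to time `t`). -/
def MPSystem.flow (S : MPSystem n M) (t : ℝ) (p : TM n M) : TM n M :=
  if h : ∃ c : (ℝ → M) × ℝ, S.IsGeodesicFrom p c.1 c.2 ∧ t ∈ Icc 0 c.2 then
    phase h.choose.1 h.choose.2 t
  else p

/-- The interval of integration `{t : 0 ≤ t ≤ τ(x, v), t < ∞}`. -/
def MPSystem.timeInterval (S : MPSystem n M) (p : TM n M) : Set ℝ :=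
  {t | 0 ≤ t ∧ ENNReal.ofReal t ≤ S.exitTime p}

/-- The integral over `0 ≤ t ≤ τ(x, v)` of `F(φ_t(x, v))` converges absolutely. -/
def MPSystem.Converges (S : MPSystem n M) (F : TM n M → ℝ) (p : TM n M) : Prop :=
  IntegrableOn (fun t => F (S.flow t p)) (S.timeInterval p)

/-- The ray transform `∫_0^{τ(x,v)} F(φ_t(x, v)) dt` of a function `F` on `TM`. -/
def MPSystem.rayIntegral (S : MPSystem n M) (F : TM n M → ℝ) (p : TM n M) : ℝ :=
  ∫ t in S.timeInterval p, F (S.flow t p)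

/-! ### Energy levels and their boundary -/

/-- The energy `E(x, v) = ½ |v|_g² + U(x)`. -/
def MPSystem.energy (S : MPSystem n M) (p : TM n M) : ℝ :=
  1 / 2 * S.g.inner p.1 p.2 p.2 + S.U p.1

/-- The differential at `x` of the boundary coordinate `x⁰` of the chart at `x`, in which `M` is
`{x⁰ ≥ 0}`. -/
def boundaryCoordDifferential (x : M) : TSp n x →L[ℝ] ℝ :=
  (EuclideanSpace.proj (0 : Fin n) : E n →L[ℝ] ℝ).comp
    ((trivializationAt (E n) (fun x : M => TSp n x) x).continuousLinearMapAt ℝ x)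

/-- The gradient of the boundary coordinate `x⁰` of the chart at `x`; for `x ∈ ∂M` it is normal to
`∂M` and points into `M`. -/
def inwardNormalVector (g : Metric n M) (x : M) : TSp n x :=
  (g.inner x).inverse (boundaryCoordDifferential x)

/-- The inward unit normal `ν(x)` to `∂M` at a boundary point `x`. -/
def inwardUnitNormal (g : Metric n M) (x : M) : TSp n x :=
  (Real.sqrt (g.inner x (inwardNormalVector g x) (inwardNormalVector g x)))⁻¹ •
    inwardNormalVector g x

/-- `∂₊SᵏM = {(x, v) : E(x, v) = k, x ∈ ∂M, (v, ν(x))_g ≥ 0}`. -/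
def MPSystem.influx (S : MPSystem n M) (k : ℝ) : Set (TM n M) :=
  {p | S.energy p = k ∧ p.1 ∈ (𝓡∂ n).boundary M ∧
    0 ≤ S.g.inner p.1 p.2 (inwardUnitNormal S.g p.1)}

/-! ### Magnetic systems and the reduction of an MP-system -/

/-- A magnetic system is an MP-system with zero potential; the notions of magnetic geodesic, exit
time and so on are those of this MP-system. -/
def MagneticSystem.toMPSystem (S : MagneticSystem n M) : MPSystem n M where
  g := S.G
  α := S.α
  U := fun _ => 0
  contMDiff_U := contMDiff_const

/-- `∂₊S^G M`, the inward pointing unit vectors at the boundary (energy `½`). -/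
def MagneticSystem.influx (S : MagneticSystem n M) : Set (TM n M) :=
  S.toMPSystem.influx (1 / 2)

/-- The conformal metric `P g`, for a positive smooth function `P`. -/
def conformalMetric (g : Metric n M) (P : M → ℝ) (hP : ContMDiff (𝓡∂ n) 𝓘(ℝ, ℝ) ∞ P)
    (hpos : ∀ x, 0 < P x) : Metric n M where
  inner x := P x • g.inner x
  symm x v w := by
    simp only [_root_.smul_apply]
    rw [g.symm]
  pos x v hv := by
    simp only [_root_.smul_apply, smul_eq_mul]
    exact mul_pos (hpos x) (g.pos x v hv)
  isVonNBounded x := by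
    have h := (g.isVonNBounded x).image
      ((Real.sqrt (P x))⁻¹ • ContinuousLinearMap.id ℝ (TSp n x))
    refine h.subset fun v hv => ?_
    have hs : 0 < Real.sqrt (P x) := Real.sqrt_pos.2 (hpos x)
    refine ⟨Real.sqrt (P x) • v, ?_, ?_⟩
    · simp only [mem_ofPred_eq, _root_.smul_apply, smul_eq_mul] at hv
      simp only [mem_ofPred_eq, map_smul, _root_.smul_apply, smul_eq_mul, ← mul_assoc]
      rwa [Real.mul_self_sqrt (hpos x).le]
    · simp [smul_smul, mul_inv_cancel₀ hs.ne']
  contMDiff := hP.smul_section g.contMDiff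

/-- The reduced magnetic system `(2(k - U) g, α)`. -/
def MPSystem.reduced (S : MPSystem n M) (k : ℝ) (hk : ∀ x, S.U x < k) : MagneticSystem n M where
  G := conformalMetric S.g (fun x => 2 * (k - S.U x))
    (contMDiff_const.mul (contMDiff_const.sub S.contMDiff_U))
    (fun x => by have := hk x; linarith)
  α := S.α

/-! ### Square integrable tensor fields -/

/-- The Riemannian volume measure: the measure with density `√det(g_{ij})` in every chart
`chartAt x₀` (the supremum of these compatible local measures). -/
def volumeMeasure [MeasurableSpace M] (g : Metric n M) : Measure M :=
  ⨆ x₀ : M, Measure.map (pt x₀)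
    ((volume.restrict (extChartAt (𝓡∂ n) x₀).target).withDensity fun y : E n =>
      ENNReal.ofReal (Real.sqrt (Matrix.det (Matrix.of fun i j : Fin n =>
        metricInChart g x₀ y (EuclideanSpace.single i 1) (EuclideanSpace.single j 1)))))

/-- `|β|_g² = g^{ij} β_i β_j`. -/
def normSqOne (g : Metric n M) (x : M) (β : TSp n x →L[ℝ] ℝ) : ℝ :=
  β ((g.inner x).inverse β)

/-- `|h|_g² = g^{ik} g^{jl} h_{ij} h_{kl} = tr (g⁻¹ h g⁻¹ h)` for symmetric `h`. -/
def normSqTwo (g : Metric n M) (x : M) (h : TSp n x →L[ℝ] TSp n x →L[ℝ] ℝ) : ℝ :=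
  let A : TSp n x →L[ℝ] TSp n x := (g.inner x).inverse.comp h
  LinearMap.trace ℝ (TSp n x) (A.comp A : TSp n x →L[ℝ] TSp n x).toLinearMap

/-- Measurability, modulo null sets, of the components of a `2`-tensor field in all charts. -/
def AEMeasurableTwo [MeasurableSpace M] (g : Metric n M)
    (h : ∀ x : M, TSp n x →L[ℝ] TSp n x →L[ℝ] ℝ) : Prop :=
  ∀ (x₀ : M) (u w : E n), AEMeasurable (fun x => h x (frame x₀ x u) (frame x₀ x w))
    ((volumeMeasure g).restrict (chartAt (EuclideanHalfSpace n) x₀).source)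

/-- Measurability, modulo null sets, of the components of a `1`-form in all charts. -/
def AEMeasurableOne [MeasurableSpace M] (g : Metric n M)
    (β : ∀ x : M, TSp n x →L[ℝ] ℝ) : Prop :=
  ∀ (x₀ : M) (u : E n), AEMeasurable (fun x => β x (frame x₀ x u))
    ((volumeMeasure g).restrict (chartAt (EuclideanHalfSpace n) x₀).source)

/-- `[h, β, V] ∈ 𝐋²(M)`: `∫ |h|² + |β|² + |V|² < ∞`. -/
def Triple.MemL2 [MeasurableSpace M] (f : Triple n M) (g : Metric n M) : Prop :=
  AEMeasurableTwo g f.h ∧ AEMeasurableOne g f.β ∧ AEMeasurable f.V (volumeMeasure g) ∧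
  ∫⁻ x, ENNReal.ofReal (normSqTwo g x (f.h x) + normSqOne g x (f.β x) + f.V x ^ 2)
    ∂(volumeMeasure g) < ⊤

/-- `[h, β] ∈ 𝐋²_𝓜(M)`: `∫ |h|² + |β|² < ∞`. -/
def Pair.MemL2 [MeasurableSpace M] (f : Pair n M) (g : Metric n M) : Prop :=
  AEMeasurableTwo g f.h ∧ AEMeasurableOne g f.β ∧
  ∫⁻ x, ENNReal.ofReal (normSqTwo g x (f.h x) + normSqOne g x (f.β x)) ∂(volumeMeasure g) < ⊤

/-! ### The ray transforms and the map `Φ` -/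

/-- The function `h_{ij}(x) vⁱ vʲ + β_i(x) vⁱ + V(x)` on `TM`. -/
def Triple.poly (f : Triple n M) (p : TM n M) : ℝ :=
  f.h p.1 p.2 p.2 + f.β p.1 p.2 + f.V p.1

/-- The function `h_{ij}(x) vⁱ vʲ + β_i(x) vⁱ` on `TM`. -/
def Pair.poly (f : Pair n M) (p : TM n M) : ℝ := f.h p.1 p.2 p.2 + f.β p.1 p.2

/-- The MP-ray transform `I[h, β, V](x, v)`. -/
def MPSystem.rayTransform (S : MPSystem n M) (f : Triple n M) (p : TM n M) : ℝ :=
  S.rayIntegral f.poly p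

/-- The magnetic ray transform `I_𝓜[h, β](x, v)`. -/
def MagneticSystem.rayTransform (S : MagneticSystem n M) (f : Pair n M) (p : TM n M) : ℝ :=
  S.toMPSystem.rayIntegral f.poly p

/-- `Φ[h, β, V] = [2(k - U) h + g V, β]`. -/
def MPSystem.Phi (S : MPSystem n M) (k : ℝ) (f : Triple n M) : Pair n M where
  h x := (2 * (k - S.U x)) • f.h x + f.V x • S.g.inner x
  h_symm x u w := by
    simp only [_root_.add_apply, _root_.smul_apply]
    rw [f.h_symm, S.g.symm]
  β := f.β

end MPRay

end

/-! This is Maupertuis' principle at fixed energy. Put `P = 2(k - U)` and `G = P g`. If `σ` is an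
MP-geodesic of energy `k` and `s(t) = ∫₀ᵗ P(σ)`, then `γ(s(t)) = σ(t)` is a `G`-unit speed magnetic
geodesic with velocity `σ̇ / P`. On the energy level `|v|_g² = P`, so `h(v,v) + β(v) + V = P ·
(Φf)(v/P)`, and the substitution `ds = P dt` turns one ray integral into the other.

The argument runs in a symmetric setting, `Conformal`, where `g' = P g` and `k' - U' = (k - U)/P`.
The inverse relation has the same form, so the time change has an inverse of the same kind. The
chart computation is `Conformal.acceleration_eq`. It is valid only on the energy level, so
conservation of energy (`MPSystem.IsGeodesic.energy_phase_eq`) is needed to use it along a curve;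
`Conformal.time_change` is the resulting statement about curves.

Flow and exit time are defined through existence of geodesics, so uniqueness
(`MPSystem.IsGeodesicFrom.eqOn`) is required before the flow can be computed from any given
geodesic. It comes from the Lipschitz property of the spray on the half space. The time change is
then a bijection of the intervals `[0, τ)` with derivative `P`, and the change of variables formula
gives both the convergence statement and the equality.

Square integrability rests on compactness, which bounds `P` and `1/P`, on `vol_G ≤ C vol_g`, and on
`(tr A)² ≤ n tr A²`, which controls the cross term in `|P h + V g|²_G`. -/

noncomputable section

set_option synthInstance.maxHeartbeats 400000
set_option maxHeartbeats 1000000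
set_option linter.unusedSectionVars false

namespace MPRay

open Filter Topology ContinuousLinearMap

/-! ### Linear algebra: inverses of positive definite forms and a trace inequality. -/

section LinearAlgebra

/-- A positive definite bilinear form on a finite dimensional space is invertible. -/
theorem isInvertible_of_posDef {F : Type*} [NormedAddCommGroup F] [NormedSpace ℝ F]
    [FiniteDimensional ℝ F] (B : F →L[ℝ] F →L[ℝ] ℝ) (hB : ∀ v, v ≠ 0 → 0 < B v v) :
    B.IsInvertible := by
  have hinj : Function.Injective (B : F →ₗ[ℝ] F →L[ℝ] ℝ) := by
    rw [← LinearMap.ker_eq_bot, LinearMap.ker_eq_bot']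
    intro v hv
    by_contra hne
    have h := hB v hne
    have hv' : B v = 0 := hv
    simp [hv'] at h
  have hdim : Module.finrank ℝ F = Module.finrank ℝ (F →L[ℝ] ℝ) := by
    rw [← (LinearMap.toContinuousLinearMap : (F →ₗ[ℝ] ℝ) ≃ₗ[ℝ] (F →L[ℝ] ℝ)).finrank_eq]
    exact (Subspace.dual_finrank_eq (K := ℝ) (V := F)).symm
  refine ⟨(LinearEquiv.ofInjectiveOfFinrankEq _ hinj hdim).toContinuousLinearEquiv, ?_⟩
  ext v w
  rfl

theorem inverse_smul_of_isInvertible {V W : Type*} [AddCommGroup V] [Module ℝ V]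
    [TopologicalSpace V] [AddCommGroup W] [Module ℝ W] [TopologicalSpace W]
    [ContinuousConstSMul ℝ V] [ContinuousConstSMul ℝ W] {A : V →L[ℝ] W}
    (hA : A.IsInvertible) {c : ℝ} (hc : c ≠ 0) : (c • A).inverse = c⁻¹ • A.inverse := by
  apply inverse_eq
  · ext v
    simp [smul_smul, hc, hA]
  · ext v
    simp [smul_smul, hc, hA]

/-- The Cauchy-Schwarz inequality `(tr A)² ≤ n tr A²` for self-adjoint `A`. -/
theorem sq_trace_le {V : Type*} [AddCommGroup V] [Module ℝ V] [FiniteDimensional ℝ V]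
    (B : LinearMap.BilinForm ℝ V) (hsymm : ∀ v w, B v w = B w v) (hpos : ∀ v, v ≠ 0 → 0 < B v v)
    (A : V →ₗ[ℝ] V) (hA : ∀ v w, B (A v) w = B v (A w)) :
    LinearMap.trace ℝ V A ^ 2 ≤ Module.finrank ℝ V * LinearMap.trace ℝ V (A ∘ₗ A) := by
  -- In a `B`-orthogonal basis the trace is the sum of the diagonal entries `B(b, Ab)/B(b, b)`. The
  -- inequality then reduces to one estimate per entry followed by Cauchy-Schwarz for the sum.
  obtain ⟨b, hb⟩ := LinearMap.BilinForm.exists_orthogonal_basis (B := B) ⟨fun v w => hsymm v w⟩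
  have hbpos : ∀ i, 0 < B (b i) (b i) := fun i => hpos _ (b.ne_zero i)
  have hrepr : ∀ v i, b.repr v i = B (b i) v / B (b i) (b i) := by
    intro v i
    rw [eq_div_iff (hbpos i).ne']
    conv_rhs => rw [← b.sum_repr v]
    rw [map_sum, Finset.sum_eq_single i]
    · simp
    · intro j _ hj
      have h : B (b i) (b j) = 0 := hb hj.symm
      simp [h]
    · simp
  have htr : ∀ C : V →ₗ[ℝ] V,
      LinearMap.trace ℝ V C = ∑ i, B (b i) (C (b i)) / B (b i) (b i) := by
    intro C
    rw [LinearMap.trace_eq_matrix_trace ℝ b]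
    simp [Matrix.trace, LinearMap.toMatrix_apply, hrepr]
  have hnonneg : ∀ v, 0 ≤ B v v := fun v => by
    rcases eq_or_ne v 0 with rfl | h
    · simp
    · exact (hpos v h).le
  have hCS : ∀ i, (B (b i) (A (b i)) / B (b i) (b i)) ^ 2
      ≤ B (b i) ((A ∘ₗ A) (b i)) / B (b i) (b i) := by
    intro i
    set c := B (b i) (A (b i)) / B (b i) (b i) with hc
    -- With `c` the coefficient of the `B`-projection of `Ab` onto `b`, positivity of the remainder
    -- gives `c² B(b,b) ≤ B(Ab,Ab) = B(b,A²b)`.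
    have h1 := hnonneg (A (b i) - c • b i)
    simp only [map_sub, map_smul, LinearMap.sub_apply, LinearMap.smul_apply, smul_eq_mul,
      hA (b i) (A (b i)), hsymm (A (b i)) (b i)] at h1
    rw [LinearMap.comp_apply, le_div_iff₀ (hbpos i)]
    have h2 : c * B (b i) (b i) = B (b i) (A (b i)) := div_mul_cancel₀ _ (hbpos i).ne'
    rw [← h2] at h1
    nlinarith
  rw [htr, htr]
  calc (∑ i, B (b i) (A (b i)) / B (b i) (b i)) ^ 2
      ≤ Fintype.card (Fin (Module.finrank ℝ V)) *
          ∑ i, (B (b i) (A (b i)) / B (b i) (b i)) ^ 2 := by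
        simpa using sq_sum_le_card_mul_sum_sq (s := Finset.univ)
          (f := fun i => B (b i) (A (b i)) / B (b i) (b i))
    _ ≤ _ := by
        rw [Fintype.card_fin]
        exact mul_le_mul_of_nonneg_left (Finset.sum_le_sum fun i _ => hCS i) (Nat.cast_nonneg _)

end LinearAlgebra

variable {n : ℕ} [NeZero n] {M : Type*} [TopologicalSpace M]
  [ChartedSpace (EuclideanHalfSpace n) M] [IsManifold (𝓡∂ n) ∞ M]

/-! ### Smoothness and invertibility of the coordinate expressions. -/

section Coordinates

theorem metric_isInvertible (g : Metric n M) (x : M) : (g.inner x).IsInvertible :=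
  isInvertible_of_posDef (F := E n) (g.inner x) (fun v hv => g.pos x v hv)

theorem pt_mem_source {x₀ : M} {y : E n} (hy : y ∈ (extChartAt (𝓡∂ n) x₀).target) :
    pt x₀ y ∈ (chartAt (EuclideanHalfSpace n) x₀).source := by
  simpa [pt] using (extChartAt (𝓡∂ n) x₀).map_target hy

theorem target_mem_nhdsWithin {x₀ : M} {y : E n} (hy : y ∈ (extChartAt (𝓡∂ n) x₀).target) :
    (extChartAt (𝓡∂ n) x₀).target ∈ 𝓝[range (𝓡∂ n)] y := by
  have := extChartAt_target_mem_nhdsWithin_of_mem (I := 𝓡∂ n) hy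
  simpa using this

theorem pt_extChartAt {x₀ x : M} (hx : x ∈ (chartAt (EuclideanHalfSpace n) x₀).source) :
    pt x₀ (extChartAt (𝓡∂ n) x₀ x) = x :=
  (extChartAt (𝓡∂ n) x₀).left_inv (by simpa using hx)

theorem contMDiffOn_pt (x₀ : M) :
    ContMDiffOn 𝓘(ℝ, E n) (𝓡∂ n) ∞ (pt x₀) (extChartAt (𝓡∂ n) x₀).target :=
  contMDiffOn_extChartAt_symm x₀

/-- A smooth function in coordinates. -/
theorem contDiffOn_comp_pt {F : Type*} [NormedAddCommGroup F] [NormedSpace ℝ F] {f : M → F}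
    {x₀ : M} (hf : ContMDiffOn (𝓡∂ n) 𝓘(ℝ, F) ∞ f (chartAt (EuclideanHalfSpace n) x₀).source) :
    ContDiffOn ℝ ∞ (fun y => f (pt x₀ y)) (extChartAt (𝓡∂ n) x₀).target := by
  rw [← contMDiffOn_iff_contDiffOn]
  exact hf.comp (contMDiffOn_pt x₀) fun y hy => pt_mem_source hy

/-- The frame is the inverse trivialization, a smooth bundle map from the trivial bundle, applied to
a constant section. Smoothness of the components of tensors follows by evaluating them on such
frames. -/
theorem frame_contMDiffOn (x₀ : M) (u : E n) :
    ContMDiffOn (𝓡∂ n) ((𝓡∂ n).prod 𝓘(ℝ, E n)) ∞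
      (fun x => TotalSpace.mk' (E n) (E := fun x : M => TSp n x) x (frame x₀ x u))
      (chartAt (EuclideanHalfSpace n) x₀).source := by
  have h := Bundle.Trivialization.contMDiffOn_symmL (IB := 𝓡∂ n) (n := ∞) (𝕜 := ℝ)
    (trivializationAt (E n) (fun x : M => TSp n x) x₀)
  have hu : ContMDiffOn (𝓡∂ n) ((𝓡∂ n).prod 𝓘(ℝ, E n)) ∞
      (fun x : M => TotalSpace.mk' (E n) (E := Bundle.Trivial M (E n)) x u)
      (chartAt (EuclideanHalfSpace n) x₀).source := by
    intro x hx
    simp only [contMDiffWithinAt_totalSpace]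
    exact ⟨contMDiffWithinAt_id, contMDiffWithinAt_const⟩
  exact ContMDiffOn.clm_bundle_apply (E₁ := Bundle.Trivial M (E n)) h hu

theorem metric_frame_contMDiffOn (g : Metric n M) (x₀ : M) (u w : E n) :
    ContMDiffOn (𝓡∂ n) 𝓘(ℝ, ℝ) ∞ (fun x => g.inner x (frame x₀ x u) (frame x₀ x w))
      (chartAt (EuclideanHalfSpace n) x₀).source := by
  have h : ContMDiffOn (𝓡∂ n) ((𝓡∂ n).prod 𝓘(ℝ, ℝ)) ∞
      (fun x => TotalSpace.mk' ℝ (E := Bundle.Trivial M ℝ) x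
        (g.inner x (frame x₀ x u) (frame x₀ x w)))
      (chartAt (EuclideanHalfSpace n) x₀).source := by
    apply ContMDiffOn.clm_bundle_apply₂ (F₁ := E n) (F₂ := E n)
    · exact g.contMDiff.contMDiffOn
    · exact frame_contMDiffOn x₀ u
    · exact frame_contMDiffOn x₀ w
  intro x hx
  have := h x hx
  simp only [contMDiffWithinAt_totalSpace] at this
  exact this.2

theorem oneForm_frame_contMDiffOn (α : OneForm n M) (x₀ : M) (u : E n) :
    ContMDiffOn (𝓡∂ n) 𝓘(ℝ, ℝ) ∞ (fun x => α.toFun x (frame x₀ x u))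
      (chartAt (EuclideanHalfSpace n) x₀).source := by
  have h : ContMDiffOn (𝓡∂ n) ((𝓡∂ n).prod 𝓘(ℝ, ℝ)) ∞
      (fun x => TotalSpace.mk' ℝ (E := Bundle.Trivial M ℝ) x (α.toFun x (frame x₀ x u)))
      (chartAt (EuclideanHalfSpace n) x₀).source := by
    apply ContMDiffOn.clm_bundle_apply (F₁ := E n)
    · exact α.contMDiff.contMDiffOn
    · exact frame_contMDiffOn x₀ u
  intro x hx
  have := h x hx
  simp only [contMDiffWithinAt_totalSpace] at this
  exact this.2

variable {x₀ : M} {y : E n}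

/-- Smoothness is known on the chart target, whereas the Christoffel symbols are formed with
derivatives within the whole half space. The two agree because the target is a neighbourhood of `y`
relative to the half space. -/
theorem metricInChart_contDiffWithinAt (g : Metric n M)
    (hy : y ∈ (extChartAt (𝓡∂ n) x₀).target) :
    ContDiffWithinAt ℝ ∞ (metricInChart g x₀) (range (𝓡∂ n)) y := by
  have h : ContDiffOn ℝ ∞ (metricInChart g x₀) (extChartAt (𝓡∂ n) x₀).target := by
    rw [contDiffOn_clm_apply]
    intro u
    rw [contDiffOn_clm_apply]
    intro w
    exact contDiffOn_comp_pt (metric_frame_contMDiffOn g x₀ u w)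
  exact (h y hy).mono_of_mem_nhdsWithin (target_mem_nhdsWithin hy)

theorem oneFormInChart_contDiffWithinAt (α : OneForm n M)
    (hy : y ∈ (extChartAt (𝓡∂ n) x₀).target) :
    ContDiffWithinAt ℝ ∞ (oneFormInChart α x₀) (range (𝓡∂ n)) y := by
  have h : ContDiffOn ℝ ∞ (oneFormInChart α x₀) (extChartAt (𝓡∂ n) x₀).target := by
    rw [contDiffOn_clm_apply]
    intro u
    exact contDiffOn_comp_pt (oneForm_frame_contMDiffOn α x₀ u)
  exact (h y hy).mono_of_mem_nhdsWithin (target_mem_nhdsWithin hy)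

theorem comp_pt_contDiffWithinAt {U : M → ℝ} (hU : ContMDiff (𝓡∂ n) 𝓘(ℝ, ℝ) ∞ U)
    (hy : y ∈ (extChartAt (𝓡∂ n) x₀).target) :
    ContDiffWithinAt ℝ ∞ (fun z : E n => U (pt x₀ z)) (range (𝓡∂ n)) y :=
  (contDiffOn_comp_pt hU.contMDiffOn y hy).mono_of_mem_nhdsWithin (target_mem_nhdsWithin hy)

theorem frame_injective {x : M} (hx : x ∈ (chartAt (EuclideanHalfSpace n) x₀).source) :
    Function.Injective (frame (n := n) x₀ x) := by
  intro u w h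
  have h1 := (trivializationAt (E n) (fun x : M => TSp n x) x₀).continuousLinearMapAt_symmL
    (R := ℝ) (b := x) (by simpa using hx)
  rw [← h1 u, ← h1 w]
  exact congrArg _ h

theorem metricInChart_apply (g : Metric n M) (u w : E n) :
    metricInChart g x₀ y u w = g.inner (pt x₀ y) (frame x₀ (pt x₀ y) u) (frame x₀ (pt x₀ y) w) :=
  rfl

theorem metricInChart_symm (g : Metric n M) (u w : E n) :
    metricInChart g x₀ y u w = metricInChart g x₀ y w u :=
  g.symm _ _ _

theorem metricInChart_isInvertible (g : Metric n M) (hy : y ∈ (extChartAt (𝓡∂ n) x₀).target) :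
    (metricInChart g x₀ y).IsInvertible := by
  refine isInvertible_of_posDef _ fun v hv => g.pos _ _ fun h => hv ?_
  exact frame_injective (pt_mem_source hy) (h.trans (map_zero _).symm)

theorem uniqueDiffWithinAt_range (hy : y ∈ (extChartAt (𝓡∂ n) x₀).target) :
    UniqueDiffWithinAt ℝ (range (𝓡∂ n)) y :=
  (𝓡∂ n).uniqueDiffOn _ (extChartAt_target_subset_range x₀ hy)

end Coordinates

end MPRay

/-! ### The geodesic equation in a chart and Maupertuis' principle for accelerations. -/

namespace MPRay

open Filter Topology ContinuousLinearMap

theorem contDiffWithinAt_flip {D F G : Type*} [NormedAddCommGroup D] [NormedSpace ℝ D]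
    [NormedAddCommGroup F] [NormedSpace ℝ F] [NormedAddCommGroup G] [NormedSpace ℝ G]
    {f : D → F →L[ℝ] F →L[ℝ] G} {s : Set D} {x : D} (hf : ContDiffWithinAt ℝ 1 f s x) :
    ContDiffWithinAt ℝ 1 (fun q => (f q).flip) s x :=
  have h : ContDiff ℝ 1 (fun B : F →L[ℝ] F →L[ℝ] G => B.flip) :=
    IsBoundedLinearMap.contDiff (IsLinearMap.with_bound ⟨fun _ _ => rfl, fun _ _ => rfl⟩ 1
      fun B => by rw [one_mul, opNorm_flip])
  h.comp_contDiffWithinAt hf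

theorem fderivWithin_smul_apply {F G : Type*} [NormedAddCommGroup F] [NormedSpace ℝ F]
    [NormedAddCommGroup G] [NormedSpace ℝ G] {p : F → ℝ} {B : F → G} {s : Set F} {y : F}
    (hs : UniqueDiffWithinAt ℝ s y) (hp : DifferentiableWithinAt ℝ p s y)
    (hB : DifferentiableWithinAt ℝ B s y) (z : F) :
    fderivWithin ℝ (fun y => p y • B y) s y z
      = p y • fderivWithin ℝ B s y z + fderivWithin ℝ p s y z • B y := by
  rw [fderivWithin_fun_smul hs hp hB]
  simp

variable {n : ℕ} [NeZero n] {M : Type*} [TopologicalSpace M]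
  [ChartedSpace (EuclideanHalfSpace n) M] [IsManifold (𝓡∂ n) ∞ M]
  {S S' : MPSystem n M} {k k' : ℝ} {P : M → ℝ} {x₀ : M} {y : E n}

/-- The acceleration in the chart at `x₀` of an MP-geodesic at `y` with velocity `u`. -/
def MPSystem.acceleration (S : MPSystem n M) (x₀ : M) (y u : E n) : E n :=
  lorentzForce S.g S.α x₀ y u - gradient S.g S.U x₀ y - christoffel S.g x₀ y u u

/-- The MP-geodesic equation with lowered indices. -/
theorem MPSystem.eq_acceleration_iff (S : MPSystem n M)
    (hy : y ∈ (extChartAt (𝓡∂ n) x₀).target) (u a : E n) :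
    a = S.acceleration x₀ y u ↔ ∀ w : E n, metricInChart S.g x₀ y a w
      + (fderivWithin ℝ (metricInChart S.g x₀) (range (𝓡∂ n)) y u u w
        - 1 / 2 * fderivWithin ℝ (metricInChart S.g x₀) (range (𝓡∂ n)) y w u u)
      = magneticField S.α x₀ y u w
        - fderivWithin ℝ (fun z : E n => S.U (pt x₀ z)) (range (𝓡∂ n)) y w := by
  have hB := metricInChart_isInvertible S.g hy
  rw [MPSystem.acceleration, lorentzForce, gradient, christoffel, christoffelOf]
  rw [← map_sub, ← map_sub, eq_comm, hB.inverse_apply_eq, ContinuousLinearMap.ext_iff]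
  refine forall_congr' fun w => ?_
  -- On the diagonal the first two Christoffel terms coincide, which leaves `D u u w - ½ D w u u`.
  simp only [_root_.sub_apply, _root_.smul_apply, _root_.add_apply, flip_apply, smul_eq_mul]
  constructor <;> intro h <;> linarith

theorem magneticField_self (α : OneForm n M) (u : E n) : magneticField α x₀ y u u = 0 := by
  simp [magneticField]

/-- The geodesic spray in the chart at `x₀` is of class `C¹`. -/
theorem MPSystem.contDiffWithinAt_spray (S : MPSystem n M)
    (hy : y ∈ (extChartAt (𝓡∂ n) x₀).target) (u : E n) :
    ContDiffWithinAt ℝ 1 (fun q : E n × E n => (q.2, S.acceleration x₀ q.1 q.2))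
      (range (𝓡∂ n) ×ˢ univ) (y, u) := by
  have hfst : ContDiffWithinAt ℝ 1 (Prod.fst : E n × E n → E n) (range (𝓡∂ n) ×ˢ univ) (y, u) :=
    contDiff_fst.contDiffWithinAt
  have hsnd : ContDiffWithinAt ℝ 1 (Prod.snd : E n × E n → E n) (range (𝓡∂ n) ×ˢ univ) (y, u) :=
    contDiff_snd.contDiffWithinAt
  have hmaps : MapsTo (Prod.fst : E n × E n → E n) (range (𝓡∂ n) ×ˢ univ) (range (𝓡∂ n)) :=
    fun q hq => hq.1
  have hyr : y ∈ range (𝓡∂ n) := extChartAt_target_subset_range x₀ hy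
  have lift : ∀ {F : Type} [NormedAddCommGroup F] [NormedSpace ℝ F] {f : E n → F},
      ContDiffWithinAt ℝ 1 f (range (𝓡∂ n)) y →
      ContDiffWithinAt ℝ 1 (fun q : E n × E n => f q.1) (range (𝓡∂ n) ×ˢ univ) (y, u) :=
    fun h => ContDiffWithinAt.comp (y, u) h hfst hmaps
  have hB := metricInChart_contDiffWithinAt S.g hy
  have hDB := lift (hB.fderivWithin_right (m := 1) (𝓡∂ n).uniqueDiffOn (by norm_cast) hyr)
  have hDα := lift ((oneFormInChart_contDiffWithinAt S.α hy).fderivWithin_right (m := 1)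
    (𝓡∂ n).uniqueDiffOn (by norm_cast) hyr)
  have hDU := lift ((comp_pt_contDiffWithinAt S.contMDiff_U hy).fderivWithin_right (m := 1)
    (𝓡∂ n).uniqueDiffOn (by norm_cast) hyr)
  have hinv : ContDiffWithinAt ℝ 1 (fun q : E n × E n => (metricInChart S.g x₀ q.1).inverse)
      (range (𝓡∂ n) ×ˢ univ) (y, u) := by
    apply lift (f := fun y => (metricInChart S.g x₀ y).inverse)
    obtain ⟨e, he⟩ := metricInChart_isInvertible S.g hy
    have h := contDiffAt_map_inverse (𝕜 := ℝ) (n := 1) e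
    rw [he] at h
    exact h.comp_contDiffWithinAt y (hB.of_le (by norm_cast))
  refine hsnd.prodMk ?_
  simp only [MPSystem.acceleration, lorentzForce, gradient, christoffel, christoffelOf,
    magneticField]
  refine ((hinv.clm_apply ((hDα.sub (contDiffWithinAt_flip hDα)).clm_apply hsnd)).sub
    (hinv.clm_apply hDU)).sub (hinv.clm_apply (ContDiffWithinAt.const_smul _ ?_))
  refine (((hDB.clm_apply hsnd).clm_apply hsnd).add
    ((hDB.clm_apply hsnd).clm_apply hsnd)).sub ?_
  exact (contDiffWithinAt_flip ((contDiffWithinAt_flip hDB).clm_apply hsnd)).clm_apply hsnd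

/-- The MP-systems `S` and `S'` are related by the Maupertuis principle at the energies `k`
and `k'`: `g' = P g`, `α' = α` and `k' - U' = (k - U) / P`. -/
structure Conformal (S S' : MPSystem n M) (k k' : ℝ) (P : M → ℝ) : Prop where
  pos : ∀ x, 0 < P x
  contMDiff : ContMDiff (𝓡∂ n) 𝓘(ℝ, ℝ) ∞ P
  inner : ∀ x, S'.g.inner x = P x • S.g.inner x
  form : S'.α = S.α
  potential : ∀ x, (k' - S'.U x) * P x = k - S.U x

/-- The symmetry supplies the inverse time change, and hence surjectivity onto the life interval of
the second system. -/
theorem Conformal.symm (h : Conformal S S' k k' P) :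
    Conformal S' S k' k (fun x => (P x)⁻¹) where
  pos x := inv_pos.2 (h.pos x)
  contMDiff := h.contMDiff.inv₀ fun x => (h.pos x).ne'
  inner x := by rw [h.inner, smul_smul, inv_mul_cancel₀ (h.pos x).ne', one_smul]
  form := h.form.symm
  potential x := by rw [← h.potential, mul_inv_cancel_right₀ (h.pos x).ne']

theorem MPSystem.conformal_reduced (S : MPSystem n M) (hk : ∀ x, S.U x < k) :
    Conformal S (S.reduced k hk).toMPSystem k (1 / 2) (fun x => 2 * (k - S.U x)) where
  pos x := by have := hk x; linarith
  contMDiff := contMDiff_const.mul (contMDiff_const.sub S.contMDiff_U)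
  inner x := rfl
  form := rfl
  potential x := by simp [MagneticSystem.toMPSystem]

/-- Maupertuis' principle in local coordinates. -/
theorem Conformal.acceleration_eq (h : Conformal S S' k k' P)
    (hy : y ∈ (extChartAt (𝓡∂ n) x₀).target) (u a : E n)
    (henergy : 1 / 2 * metricInChart S.g x₀ y u u + S.U (pt x₀ y) = k)
    (ha : a = S.acceleration x₀ y u) :
    (P (pt x₀ y) ^ 2)⁻¹ • a - (fderivWithin ℝ (fun z : E n => P (pt x₀ z)) (range (𝓡∂ n)) y u
        * (P (pt x₀ y) ^ 3)⁻¹) • u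
      = S'.acceleration x₀ y ((P (pt x₀ y))⁻¹ • u) := by
  rw [S.eq_acceleration_iff hy] at ha
  rw [S'.eq_acceleration_iff hy]
  intro w
  have hud := uniqueDiffWithinAt_range hy
  have hB := (metricInChart_contDiffWithinAt S.g hy).differentiableWithinAt (by simp)
  have hP := (comp_pt_contDiffWithinAt h.contMDiff hy).differentiableWithinAt (by simp)
  have hU := (comp_pt_contDiffWithinAt S.contMDiff_U hy).differentiableWithinAt (by simp)
  have hU' := (comp_pt_contDiffWithinAt S'.contMDiff_U hy).differentiableWithinAt (by simp)
  have hmetric : metricInChart S'.g x₀ = fun z => P (pt x₀ z) • metricInChart S.g x₀ z := by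
    ext z u w
    simp [metricInChart_apply, h.inner]
  have hD : ∀ z, fderivWithin ℝ (metricInChart S'.g x₀) (range (𝓡∂ n)) y z
      = P (pt x₀ y) • fderivWithin ℝ (metricInChart S.g x₀) (range (𝓡∂ n)) y z
        + fderivWithin ℝ (fun z : E n => P (pt x₀ z)) (range (𝓡∂ n)) y z
          • metricInChart S.g x₀ y := by
    intro z
    rw [hmetric]
    exact fderivWithin_smul_apply hud hP hB z
  have hpot : ∀ z, -(fderivWithin ℝ (fun z : E n => S'.U (pt x₀ z)) (range (𝓡∂ n)) y z
        * P (pt x₀ y)) + (k' - S'.U (pt x₀ y))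
          * fderivWithin ℝ (fun z : E n => P (pt x₀ z)) (range (𝓡∂ n)) y z
      = -fderivWithin ℝ (fun z : E n => S.U (pt x₀ z)) (range (𝓡∂ n)) y z := by
    intro z
    have h1 := (((hU'.hasFDerivWithinAt.const_sub k').mul hP.hasFDerivWithinAt).fderivWithin hud)
    have h2 := (hU.hasFDerivWithinAt.const_sub k).fderivWithin hud
    have h3 : (fun z : E n => (k' - S'.U (pt x₀ z)) * P (pt x₀ z)) =
        fun z => k - S.U (pt x₀ z) := funext fun z => h.potential _
    have h4 : ((fun z : E n => k' - S'.U (pt x₀ z)) * fun z => P (pt x₀ z)) =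
        fun z => k - S.U (pt x₀ z) := h3
    rw [h4, h2] at h1
    have h5 := congrArg (fun L : E n →L[ℝ] ℝ => L z) h1
    simp only [_root_.neg_apply, _root_.add_apply, _root_.smul_apply, smul_eq_mul] at h5
    linarith
  have e1 := ha w
  have e2 := hpot w
  have e3 := h.potential (pt x₀ y)
  have hPy := (h.pos (pt x₀ y)).ne'
  have e4 : ∀ v, metricInChart S'.g x₀ y v w = P (pt x₀ y) * metricInChart S.g x₀ y v w := by
    intro v
    rw [hmetric]
    rfl
  rw [h.form, e4]
  simp only [hD, map_sub, map_smul, _root_.add_apply, _root_.smul_apply, _root_.sub_apply,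
    smul_eq_mul]
  generalize fderivWithin ℝ (fun z : E n => P (pt x₀ z)) (range (𝓡∂ n)) y = dP at *
  generalize fderivWithin ℝ (fun z : E n => S.U (pt x₀ z)) (range (𝓡∂ n)) y w = dU at *
  generalize fderivWithin ℝ (fun z : E n => S'.U (pt x₀ z)) (range (𝓡∂ n)) y w = dU' at *
  generalize P (pt x₀ y) = p at *
  generalize S.U (pt x₀ y) = U at *
  generalize S'.U (pt x₀ y) = U' at *
  generalize metricInChart S.g x₀ y = B at *
  -- The `dP(u)` terms cancel by themselves. The terms in `dP w` are `½ B(u,u) dP w / p²` from the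
  -- metric and `(k' - U') dP w / p` from the potential; they match precisely because `½ B(u,u) = k
  -- - U = (k' - U') p`.
  linear_combination (norm := (field_simp; ring)) (1 / p) * e1 - (1 / p) * e2
    - dP w / p ^ 2 * (henergy - e3)

/-- The derivative of the energy along an MP-geodesic vanishes. -/
theorem MPSystem.energy_derivative (S : MPSystem n M)
    (hy : y ∈ (extChartAt (𝓡∂ n) x₀).target) (u : E n) :
    1 / 2 * (fderivWithin ℝ (metricInChart S.g x₀) (range (𝓡∂ n)) y u u u
        + 2 * metricInChart S.g x₀ y (S.acceleration x₀ y u) u)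
      + fderivWithin ℝ (fun z : E n => S.U (pt x₀ z)) (range (𝓡∂ n)) y u = 0 := by
  -- Contracted with the velocity itself, the magnetic term drops out by antisymmetry: the Lorentz
  -- force does no work.
  have h := (S.eq_acceleration_iff hy u _).1 rfl u
  rw [magneticField_self] at h
  linarith

end MPRay

/-! ### Curves in charts, restriction of geodesics, conservation of energy. -/

namespace MPRay

open Filter Topology

theorem hasDerivWithinAt_comp_of_mapsTo {F G : Type*} [NormedAddCommGroup F] [NormedSpace ℝ F]
    [NormedAddCommGroup G] [NormedSpace ℝ G] {B : F → G} {r : Set F} {y : ℝ → F} {s : Set ℝ}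
    {t : ℝ} {a : F} {D : F →L[ℝ] G} (hB : HasFDerivWithinAt B D r (y t)) (hr : MapsTo y s r)
    (hy : HasDerivWithinAt y a s t) : HasDerivWithinAt (fun t => B (y t)) (D a) s t :=
  HasFDerivWithinAt.comp_hasDerivWithinAt t hB hy hr

theorem hasDerivWithinAt_bilin {F : Type*} [NormedAddCommGroup F] [NormedSpace ℝ F]
    {B : F → F →L[ℝ] F →L[ℝ] ℝ} {r : Set F} {y y' : ℝ → F} {s : Set ℝ} {t : ℝ} {a : F}
    {D : F →L[ℝ] F →L[ℝ] F →L[ℝ] ℝ} (hB : HasFDerivWithinAt B D r (y t))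
    (hr : MapsTo y s r) (hy : HasDerivWithinAt y (y' t) s t) (hy' : HasDerivWithinAt y' a s t) :
    HasDerivWithinAt (fun t => B (y t) (y' t) (y' t))
      (D (y' t) (y' t) (y' t) + B (y t) a (y' t) + B (y t) (y' t) a) s t := by
  have h1 : HasDerivWithinAt (fun t => B (y t)) (D (y' t)) s t :=
    hasDerivWithinAt_comp_of_mapsTo (F := F) (G := F →L[ℝ] F →L[ℝ] ℝ) hB hr hy
  have h2 : HasDerivWithinAt (fun t => B (y t) (y' t)) (D (y' t) (y' t) + B (y t) a) s t :=
    h1.clm_apply hy'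
  exact h2.clm_apply hy'

variable {n : ℕ} [NeZero n] {M : Type*} [TopologicalSpace M]
  [ChartedSpace (EuclideanHalfSpace n) M] [IsManifold (𝓡∂ n) ∞ M]
  {S : MPSystem n M} {σ : ℝ → M} {T t : ℝ} {x₀ : M}

/-- The coordinates of a curve in the chart at `x₀`. -/
def coords (x₀ : M) (σ : ℝ → M) (t : ℝ) : E n := extChartAt (𝓡∂ n) x₀ (σ t)

/-- The coordinate velocity in the chart at `x₀` of a curve on `[0, T]`. -/
def velocity (x₀ : M) (σ : ℝ → M) (T : ℝ) : ℝ → E n := derivWithin (coords x₀ σ) (Icc 0 T)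

theorem MPSystem.isGeodesic_iff : S.IsGeodesic σ T ↔
    0 < T ∧ ContMDiffOn 𝓘(ℝ, ℝ) (𝓡∂ n) 2 σ (Icc 0 T) ∧
    ∀ x₀ : M, ∀ t ∈ Icc 0 T, σ t ∈ (chartAt (EuclideanHalfSpace n) x₀).source →
      derivWithin (velocity x₀ σ T) (Icc 0 T) t
        = S.acceleration x₀ (coords x₀ σ t) (velocity x₀ σ T t) := by
  refine and_congr_right fun _ => and_congr_right fun _ => forall_congr' fun x₀ =>
    forall_congr' fun t => forall_congr' fun _ => forall_congr' fun _ => ?_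
  rw [MPSystem.acceleration]
  exact Iff.trans Iff.rfl eq_sub_iff_add_eq.symm

theorem coords_mem_target (ht : σ t ∈ (chartAt (EuclideanHalfSpace n) x₀).source) :
    coords x₀ σ t ∈ (extChartAt (𝓡∂ n) x₀).target :=
  (extChartAt (𝓡∂ n) x₀).map_source (by simpa using ht)

theorem coords_mapsTo_range (s : Set ℝ) :
    MapsTo (coords (n := n) x₀ σ) s (range (𝓡∂ n)) := fun _ _ => mem_range_self _

theorem pt_coords (ht : σ t ∈ (chartAt (EuclideanHalfSpace n) x₀).source) :
    pt x₀ (coords (n := n) x₀ σ t) = σ t :=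
  pt_extChartAt ht

theorem source_mem_nhdsWithin {s : Set ℝ} (hσ : ContinuousWithinAt σ s t)
    (ht : σ t ∈ (chartAt (EuclideanHalfSpace n) x₀).source) :
    ∀ᶠ r in 𝓝[s] t, σ r ∈ (chartAt (EuclideanHalfSpace n) x₀).source :=
  hσ.eventually ((chartAt (EuclideanHalfSpace n) x₀).open_source.mem_nhds ht)

theorem coords_contDiffWithinAt {m : ℕ∞} {s : Set ℝ}
    (hσ : ContMDiffWithinAt 𝓘(ℝ, ℝ) (𝓡∂ n) m σ s t)
    (ht : σ t ∈ (chartAt (EuclideanHalfSpace n) x₀).source) :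
    ContDiffWithinAt ℝ m (coords (n := n) x₀ σ) s t := by
  rw [← contMDiffWithinAt_iff_contDiffWithinAt]
  have : IsManifold (𝓡∂ n) (m : WithTop ℕ∞) M := IsManifold.of_le (n := ∞) (by exact_mod_cast le_top)
  exact (contMDiffAt_extChartAt' ht).comp_contMDiffWithinAt t hσ

theorem hasDerivWithinAt_coords (hσ : ContMDiffOn 𝓘(ℝ, ℝ) (𝓡∂ n) 2 σ (Icc 0 T))
    (htT : t ∈ Icc 0 T) (ht : σ t ∈ (chartAt (EuclideanHalfSpace n) x₀).source) :
    HasDerivWithinAt (coords (n := n) x₀ σ) (velocity x₀ σ T t) (Icc 0 T) t :=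
  ((coords_contDiffWithinAt (m := 2) (hσ t htT) ht).differentiableWithinAt
    (by simp)).hasDerivWithinAt

theorem velocity_contDiffWithinAt (hT : 0 < T)
    (hσ : ContMDiffOn 𝓘(ℝ, ℝ) (𝓡∂ n) 2 σ (Icc 0 T)) (htT : t ∈ Icc 0 T)
    (ht : σ t ∈ (chartAt (EuclideanHalfSpace n) x₀).source) :
    ContDiffWithinAt ℝ 1 (velocity (n := n) x₀ σ T) (Icc 0 T) t := by
  have h := (coords_contDiffWithinAt (m := 2) (hσ t htT) ht).fderivWithin_right (m := 1)
    (uniqueDiffOn_Icc hT) (by norm_cast) htT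
  have h1 := h.clm_apply (contDiffWithinAt_const (c := (1 : ℝ)))
  exact h1

theorem MPSystem.IsGeodesic.hasDerivWithinAt_velocity (h : S.IsGeodesic σ T) (htT : t ∈ Icc 0 T)
    (ht : σ t ∈ (chartAt (EuclideanHalfSpace n) x₀).source) :
    HasDerivWithinAt (velocity x₀ σ T)
      (S.acceleration x₀ (coords x₀ σ t) (velocity x₀ σ T t)) (Icc 0 T) t := by
  obtain ⟨hT, hσ, heq⟩ := MPSystem.isGeodesic_iff.1 h
  rw [← heq x₀ t htT ht]
  exact ((velocity_contDiffWithinAt hT hσ htT ht).differentiableWithinAt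
    (by simp)).hasDerivWithinAt

/-- A `C²` curve solving the geodesic equation as a first order system in all charts is an
MP-geodesic. -/
theorem MPSystem.isGeodesic_of_system (hT : 0 < T)
    (hσ : ContMDiffOn 𝓘(ℝ, ℝ) (𝓡∂ n) 2 σ (Icc 0 T)) (z' : M → ℝ → E n)
    (h1 : ∀ x₀ : M, ∀ t ∈ Icc 0 T, σ t ∈ (chartAt (EuclideanHalfSpace n) x₀).source →
      HasDerivWithinAt (coords x₀ σ) (z' x₀ t) (Icc 0 T) t)
    (h2 : ∀ x₀ : M, ∀ t ∈ Icc 0 T, σ t ∈ (chartAt (EuclideanHalfSpace n) x₀).source →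
      HasDerivWithinAt (z' x₀) (S.acceleration x₀ (coords x₀ σ t) (z' x₀ t)) (Icc 0 T) t) :
    S.IsGeodesic σ T := by
  refine MPSystem.isGeodesic_iff.2 ⟨hT, hσ, fun x₀ t htT ht => ?_⟩
  have hud := uniqueDiffOn_Icc hT
  have hv : ∀ r ∈ Icc 0 T, σ r ∈ (chartAt (EuclideanHalfSpace n) x₀).source →
      velocity x₀ σ T r = z' x₀ r := fun r hr hr' => (h1 x₀ r hr hr').derivWithin (hud r hr)
  rw [hv t htT ht]
  refine ((h2 x₀ t htT ht).congr_of_eventuallyEq ?_ (hv t htT ht)).derivWithin (hud t htT)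
  filter_upwards [source_mem_nhdsWithin (hσ.continuousOn t htT) ht, self_mem_nhdsWithin]
    with r hr hr' using hv r hr' hr

/-- A derivative within a smaller interval is the same derivative as long as the smaller interval
has unique derivatives. This makes the notions independent of the chosen lifetime. -/
theorem velocity_restrict {T' : ℝ} (hT' : 0 < T') (hTT' : T' ≤ T)
    (hσ : ContMDiffOn 𝓘(ℝ, ℝ) (𝓡∂ n) 2 σ (Icc 0 T)) (htT : t ∈ Icc 0 T')
    (ht : σ t ∈ (chartAt (EuclideanHalfSpace n) x₀).source) :
    velocity (n := n) x₀ σ T' t = velocity x₀ σ T t :=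
  ((hasDerivWithinAt_coords hσ ⟨htT.1, htT.2.trans hTT'⟩ ht).mono
    (Icc_subset_Icc_right hTT')).derivWithin (uniqueDiffOn_Icc hT' t htT)

theorem MPSystem.IsGeodesic.restrict (h : S.IsGeodesic σ T) {T' : ℝ} (hT' : 0 < T')
    (hTT' : T' ≤ T) : S.IsGeodesic σ T' := by
  have hsub : Icc 0 T' ⊆ Icc 0 T := Icc_subset_Icc_right hTT'
  refine MPSystem.isGeodesic_of_system hT' (h.2.1.mono hsub) (fun x₀ => velocity x₀ σ T) ?_ ?_
  · exact fun x₀ t htT ht => (hasDerivWithinAt_coords h.2.1 (hsub htT) ht).mono hsub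
  · exact fun x₀ t htT ht => (h.hasDerivWithinAt_velocity (hsub htT) ht).mono hsub

theorem phase_restrict {T' : ℝ} (hT' : 0 < T') (hTT' : T' ≤ T)
    (hσ : ContMDiffOn 𝓘(ℝ, ℝ) (𝓡∂ n) 2 σ (Icc 0 T)) (htT : t ∈ Icc 0 T') :
    phase (n := n) σ T' t = phase σ T t := by
  have hsub : Icc 0 T' ⊆ Icc 0 T := Icc_subset_Icc_right hTT'
  have h : mfderivWithin 𝓘(ℝ, ℝ) (𝓡∂ n) σ (Icc 0 T') t
      = mfderivWithin 𝓘(ℝ, ℝ) (𝓡∂ n) σ (Icc 0 T) t :=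
    mfderivWithin_subset hsub (uniqueDiffOn_Icc hT' t htT).uniqueMDiffWithinAt
      ((hσ t (hsub htT)).mdifferentiableWithinAt (by simp))
  rw [phase, phase, h]

theorem MPSystem.IsGeodesicFrom.restrict {p : TM n M} (h : S.IsGeodesicFrom p σ T) {T' : ℝ}
    (hT' : 0 < T') (hTT' : T' ≤ T) : S.IsGeodesicFrom p σ T' :=
  ⟨h.1.restrict hT' hTT', by
    rw [phase_restrict hT' hTT' h.1.2.1 (left_mem_Icc.2 hT'.le), h.2]⟩

/-- The velocity of a curve in terms of its coordinates. -/
theorem mfderivWithin_eq_frame (hT : 0 < T)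
    (hσ : ContMDiffOn 𝓘(ℝ, ℝ) (𝓡∂ n) 2 σ (Icc 0 T)) (htT : t ∈ Icc 0 T)
    (ht : σ t ∈ (chartAt (EuclideanHalfSpace n) x₀).source) :
    mfderivWithin 𝓘(ℝ, ℝ) (𝓡∂ n) σ (Icc 0 T) t (1 : ℝ)
      = frame x₀ (σ t) (velocity x₀ σ T t) := by
  have hud := (uniqueDiffOn_Icc hT t htT)
  have : IsManifold (𝓡∂ n) 1 M := IsManifold.of_le (n := ∞) (by exact_mod_cast le_top)
  have h1 := mfderiv_comp_mfderivWithin (x := t) (s := Icc 0 T) (f := σ)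
    (g := extChartAt (𝓡∂ n) x₀) (I := 𝓘(ℝ, ℝ)) (I' := 𝓡∂ n) (I'' := 𝓘(ℝ, E n))
    (mdifferentiableAt_extChartAt ht)
    ((hσ t htT).mdifferentiableWithinAt (by simp)) hud.uniqueMDiffWithinAt
  rw [← TangentBundle.continuousLinearMapAt_trivializationAt ht] at h1
  have h2 : mfderivWithin 𝓘(ℝ, ℝ) 𝓘(ℝ, E n) (extChartAt (𝓡∂ n) x₀ ∘ σ) (Icc 0 T) t (1 : ℝ)
      = velocity x₀ σ T t := by
    rw [mfderivWithin_eq_fderivWithin]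
    rfl
  rw [h1] at h2
  rw [← h2]
  exact ((trivializationAt (E n) (fun x : M => TSp n x) x₀).symmL_continuousLinearMapAt
    (R := ℝ) (b := σ t) (by simpa using ht) _).symm

theorem MPSystem.energy_phase (hT : 0 < T)
    (hσ : ContMDiffOn 𝓘(ℝ, ℝ) (𝓡∂ n) 2 σ (Icc 0 T)) (htT : t ∈ Icc 0 T)
    (ht : σ t ∈ (chartAt (EuclideanHalfSpace n) x₀).source) :
    S.energy (phase σ T t) = 1 / 2 * metricInChart S.g x₀ (coords x₀ σ t) (velocity x₀ σ T t)
      (velocity x₀ σ T t) + S.U (pt x₀ (coords (n := n) x₀ σ t)) := by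
  rw [metricInChart_apply, pt_coords ht, ← mfderivWithin_eq_frame hT hσ htT ht]
  rfl

/-- Conservation of energy. -/
theorem MPSystem.IsGeodesic.energy_phase_eq (h : S.IsGeodesic σ T) (htT : t ∈ Icc 0 T) :
    S.energy (phase σ T t) = S.energy (phase σ T 0) := by
  have hT := h.1
  have hσ := h.2.1
  have key : ∀ t ∈ Icc 0 T, HasDerivWithinAt (fun t => S.energy (phase σ T t)) 0 (Icc 0 T) t := by
    intro t htT
    obtain ⟨x₀, ht⟩ : ∃ x₀ : M, σ t ∈ (chartAt (EuclideanHalfSpace n) x₀).source :=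
      ⟨σ t, mem_chart_source _ _⟩
    have hy := coords_mem_target ht
    have hB := ((metricInChart_contDiffWithinAt S.g hy).differentiableWithinAt
      (by simp)).hasFDerivWithinAt
    have hU := ((comp_pt_contDiffWithinAt S.contMDiff_U hy).differentiableWithinAt
      (by simp)).hasFDerivWithinAt
    have h1 := hasDerivWithinAt_coords hσ htT ht
    have h2 := hasDerivWithinAt_bilin hB (coords_mapsTo_range _) h1
      (h.hasDerivWithinAt_velocity htT ht)
    have h3 := hU.comp_hasDerivWithinAt t h1 (coords_mapsTo_range _)
    have h4 := (h2.const_mul (1 / 2)).add h3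
    have h5 : HasDerivWithinAt (fun t => 1 / 2 * metricInChart S.g x₀ (coords x₀ σ t)
        (velocity x₀ σ T t) (velocity x₀ σ T t) + S.U (pt x₀ (coords (n := n) x₀ σ t))) 0
        (Icc 0 T) t := by
      refine h4.congr_deriv ?_
      rw [← S.energy_derivative hy (velocity x₀ σ T t),
        metricInChart_symm S.g (velocity x₀ σ T t)]
      ring
    refine h5.congr_of_eventuallyEq ?_ (MPSystem.energy_phase hT hσ htT ht)
    filter_upwards [source_mem_nhdsWithin (hσ.continuousOn t htT) ht, self_mem_nhdsWithin]
      with r hr hr' using MPSystem.energy_phase hT hσ hr' hr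
  refine constant_of_derivWithin_zero (fun t ht => (key t ht).differentiableWithinAt)
    (fun t ht => ?_) t htT
  exact (key t (Ico_subset_Icc_self ht)).derivWithin
    (uniqueDiffOn_Icc hT t (Ico_subset_Icc_self ht))

end MPRay

/-! ### Uniqueness of MP-geodesics and the flow. -/

namespace MPRay

open Filter Topology

variable {n : ℕ} [NeZero n] {M : Type*} [TopologicalSpace M]
  [ChartedSpace (EuclideanHalfSpace n) M] [IsManifold (𝓡∂ n) ∞ M]
  {S : MPSystem n M} {σ σ₁ σ₂ : ℝ → M} {T T₁ T₂ t : ℝ} {x₀ : M} {p : TM n M}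

theorem velocity_eq_continuousLinearMapAt (hT : 0 < T)
    (hσ : ContMDiffOn 𝓘(ℝ, ℝ) (𝓡∂ n) 2 σ (Icc 0 T)) (htT : t ∈ Icc 0 T)
    (ht : σ t ∈ (chartAt (EuclideanHalfSpace n) x₀).source) :
    velocity x₀ σ T t = (trivializationAt (E n) (fun x : M => TSp n x) x₀).continuousLinearMapAt
      ℝ (phase (n := n) σ T t).1 (phase (n := n) σ T t).2 := by
  have h := mfderivWithin_eq_frame hT hσ htT ht
  have h1 := (trivializationAt (E n) (fun x : M => TSp n x) x₀).continuousLinearMapAt_symmL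
    (R := ℝ) (b := σ t) (by simpa using ht) (velocity x₀ σ T t)
  refine h1.symm.trans ?_
  exact congrArg _ h.symm

/-- Two geodesics which agree up to time `t` in position and velocity agree for a short time
after `t`. -/
theorem MPSystem.IsGeodesic.eventually_eq (h₁ : S.IsGeodesic σ₁ T) (h₂ : S.IsGeodesic σ₂ T)
    (ht : t ∈ Ico 0 T) (h₁s : σ₁ t ∈ (chartAt (EuclideanHalfSpace n) x₀).source)
    (heq : σ₁ t = σ₂ t) (hv : velocity x₀ σ₁ T t = velocity (n := n) x₀ σ₂ T t) :
    ∃ u, t < u ∧ u ≤ T ∧ EqOn σ₁ σ₂ (Icc t u) := by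
  have h₂s : σ₂ t ∈ (chartAt (EuclideanHalfSpace n) x₀).source := heq ▸ h₁s
  have htT : t ∈ Icc 0 T := Ico_subset_Icc_self ht
  -- At boundary points the spray is defined only on a half space. Convexity of the half space makes
  -- a `C¹` map Lipschitz near the point relative to it, and this suffices for ODE uniqueness since
  -- both curves stay inside.
  obtain ⟨K, V, hV, hK⟩ := (S.contDiffWithinAt_spray (coords_mem_target h₁s)
    (velocity x₀ σ₁ T t)).exists_lipschitzOnWith
    ((𝓡∂ n).convex_range.prod convex_univ)
  have hderiv : ∀ {σ : ℝ → M}, S.IsGeodesic σ T → ∀ r ∈ Icc 0 T,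
      σ r ∈ (chartAt (EuclideanHalfSpace n) x₀).source →
      HasDerivWithinAt (fun r => (coords x₀ σ r, velocity (n := n) x₀ σ T r))
        (velocity x₀ σ T r, S.acceleration x₀ (coords x₀ σ r) (velocity x₀ σ T r))
        (Icc 0 T) r := fun h r hr hrs =>
    (hasDerivWithinAt_coords h.2.1 hr hrs).prodMk (h.hasDerivWithinAt_velocity hr hrs)
  have hev : ∀ {σ : ℝ → M}, S.IsGeodesic σ T →
      σ t ∈ (chartAt (EuclideanHalfSpace n) x₀).source →
      (coords (n := n) x₀ σ t, velocity (n := n) x₀ σ T t)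
        = (coords x₀ σ₁ t, velocity x₀ σ₁ T t) →
      ∀ᶠ r in 𝓝[Icc 0 T] t, σ r ∈ (chartAt (EuclideanHalfSpace n) x₀).source ∧
        (coords x₀ σ r, velocity (n := n) x₀ σ T r) ∈ V := by
    intro σ h hs he
    refine (source_mem_nhdsWithin (n := n) (h.2.1.continuousOn t htT) hs).and ?_
    have hc := (hderiv h t htT hs).continuousWithinAt.tendsto_nhdsWithin
      (t := range (𝓡∂ n) ×ˢ (univ : Set (E n))) (fun r _ => ⟨mem_range_self _, mem_univ _⟩)
    rw [he] at hc
    exact hc hV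
  have hcoords : coords (n := n) x₀ σ₂ t = coords x₀ σ₁ t := by rw [coords, coords, heq]
  have hboth := (hev h₁ h₁s rfl).and (hev h₂ h₂s (by rw [hcoords, hv]))
  have hGE : 𝓝[≥] t ≤ 𝓝[Icc 0 T] t :=
    nhdsWithin_le_of_mem (mem_of_superset (Icc_mem_nhdsGE ht.2) (Icc_subset_Icc_left ht.1))
  obtain ⟨u, hu, hsub⟩ := mem_nhdsGE_iff_exists_Icc_subset.1 (hGE hboth)
  set w := min u T with hw
  have htw : t < w := lt_min hu ht.2
  have hsub' : ∀ r ∈ Icc t w, r ∈ Icc 0 T ∧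
      (σ₁ r ∈ (chartAt (EuclideanHalfSpace n) x₀).source ∧
        (coords x₀ σ₁ r, velocity (n := n) x₀ σ₁ T r) ∈ V) ∧
      σ₂ r ∈ (chartAt (EuclideanHalfSpace n) x₀).source ∧
        (coords x₀ σ₂ r, velocity (n := n) x₀ σ₂ T r) ∈ V := fun r hr =>
    ⟨⟨ht.1.trans hr.1, hr.2.trans (min_le_right _ _)⟩, hsub ⟨hr.1, hr.2.trans (min_le_left _ _)⟩⟩
  have hGEr : ∀ r ∈ Ico t w, Icc 0 T ∈ 𝓝[Ici r] r := fun r hr =>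
    mem_of_superset (Icc_mem_nhdsGE (hr.2.trans_le (min_le_right _ _)))
      (Icc_subset_Icc_left (ht.1.trans hr.1))
  have huniq := ODE_solution_unique_of_mem_Icc_right (a := t) (b := w)
    (v := fun _ q => (q.2, S.acceleration x₀ q.1 q.2)) (s := fun _ => V) (K := K)
    (f := fun r => (coords x₀ σ₁ r, velocity (n := n) x₀ σ₁ T r))
    (g := fun r => (coords x₀ σ₂ r, velocity (n := n) x₀ σ₂ T r))
    (fun _ _ => hK)
    (fun r hr => ((hderiv h₁ r (hsub' r hr).1 (hsub' r hr).2.1.1).continuousWithinAt).mono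
      fun r hr => (hsub' r hr).1)
    (fun r hr => (hderiv h₁ r (hsub' r (Ico_subset_Icc_self hr)).1
      (hsub' r (Ico_subset_Icc_self hr)).2.1.1).mono_of_mem_nhdsWithin (hGEr r hr))
    (fun r hr => (hsub' r (Ico_subset_Icc_self hr)).2.1.2)
    (fun r hr => ((hderiv h₂ r (hsub' r hr).1 (hsub' r hr).2.2.1).continuousWithinAt).mono
      fun r hr => (hsub' r hr).1)
    (fun r hr => (hderiv h₂ r (hsub' r (Ico_subset_Icc_self hr)).1
      (hsub' r (Ico_subset_Icc_self hr)).2.2.1).mono_of_mem_nhdsWithin (hGEr r hr))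
    (fun r hr => (hsub' r (Ico_subset_Icc_self hr)).2.2.2)
    (by rw [hcoords, hv])
  refine ⟨w, htw, min_le_right _ _, fun r hr => ?_⟩
  have h1 := congrArg Prod.fst (huniq hr)
  exact (extChartAt (𝓡∂ n) x₀).injOn (by simpa using (hsub' r hr).2.1.1)
    (by simpa using (hsub' r hr).2.2.1) h1

/-- Continuous induction on the times `t` up to which the curves agree: this set is closed since `M`
is Hausdorff, and it extends to the right by local uniqueness. -/
theorem MPSystem.IsGeodesicFrom.eqOn [T2Space M] (h₁ : S.IsGeodesicFrom p σ₁ T)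
    (h₂ : S.IsGeodesicFrom p σ₂ T) : EqOn σ₁ σ₂ (Icc 0 T) := by
  have hT := h₁.1.1
  have hA : IsClosed {t ∈ Icc 0 T | σ₁ t = σ₂ t} := by
    have h := (h₁.1.2.1.continuousOn.prodMk h₂.1.2.1.continuousOn).preimage_isClosed_of_isClosed
      isClosed_Icc isClosed_diagonal
    exact h
  have h0 : σ₁ 0 = σ₂ 0 := by
    have h : (phase (n := n) σ₁ T 0).1 = (phase (n := n) σ₂ T 0).1 := by rw [h₁.2, h₂.2]
    exact h
  suffices h : Icc 0 T ⊆ {t | EqOn σ₁ σ₂ (Icc 0 t)} from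
    fun t ht => h ht (right_mem_Icc.2 ht.1)
  refine IsClosed.Icc_subset_of_forall_mem_nhdsWithin ?_ ?_ ?_
  · refine isClosed_of_closure_subset fun t ht => ?_
    have htT : t ∈ Icc 0 T := closure_minimal inter_subset_right isClosed_Icc ht
    refine ⟨fun r hr => ?_, htT⟩
    rcases hr.2.lt_or_eq with hlt | rfl
    · obtain ⟨t', ht', ht'2⟩ := mem_closure_iff.1 ht (Ioi r) isOpen_Ioi hlt
      exact ht'2.1 ⟨hr.1, le_of_lt ht'⟩
    · have hsub : {t | EqOn σ₁ σ₂ (Icc 0 t)} ∩ Icc 0 T ⊆ {t ∈ Icc 0 T | σ₁ t = σ₂ t} :=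
        fun t' ht' => ⟨ht'.2, ht'.1 (right_mem_Icc.2 ht'.2.1)⟩
      exact (closure_minimal hsub hA ht).2
  · rintro r ⟨hr0, hr1⟩
    rwa [le_antisymm hr1 hr0]
  · rintro t ⟨ht, htT⟩
    have heq : σ₁ t = σ₂ t := ht (right_mem_Icc.2 htT.1)
    have hs₁ : σ₁ t ∈ (chartAt (EuclideanHalfSpace n) (σ₁ t)).source := mem_chart_source _ _
    have hs₂ : σ₂ t ∈ (chartAt (EuclideanHalfSpace n) (σ₁ t)).source := heq ▸ hs₁
    -- At `t = 0` the velocities agree by the common initial data. For `t > 0` each equals the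
    -- derivative within `[0, t]`, where the curves coincide.
    have hv : velocity (σ₁ t) σ₁ T t = velocity (n := n) (σ₁ t) σ₂ T t := by
      rcases htT.1.eq_or_lt with h | h
      · subst h
        rw [velocity_eq_continuousLinearMapAt hT h₁.1.2.1 (left_mem_Icc.2 hT.le) hs₁,
          velocity_eq_continuousLinearMapAt hT h₂.1.2.1 (left_mem_Icc.2 hT.le) hs₂, h₁.2, h₂.2]
      · have htt : t ∈ Icc 0 t := right_mem_Icc.2 h.le
        rw [← velocity_restrict h htT.2.le h₁.1.2.1 htt hs₁,
          ← velocity_restrict h htT.2.le h₂.1.2.1 htt hs₂]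
        refine derivWithin_congr (fun r hr => ?_) ?_
        · rw [coords, coords, ht hr]
        · rw [coords, coords, heq]
    obtain ⟨u, htu, -, hu⟩ := h₁.1.eventually_eq h₂.1 htT hs₁ heq hv
    refine mem_of_superset (Ioo_mem_nhdsGT htu) fun r hr r' hr' => ?_
    rcases le_total r' t with hle | hle
    · exact ht ⟨hr'.1, hle⟩
    · exact hu ⟨hle, hr'.2.trans hr.2.le⟩

theorem MPSystem.IsGeodesicFrom.phase_eq [T2Space M] (h₁ : S.IsGeodesicFrom p σ₁ T₁)
    (h₂ : S.IsGeodesicFrom p σ₂ T₂) (ht₁ : t ∈ Icc 0 T₁) (ht₂ : t ∈ Icc 0 T₂) :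
    phase (n := n) σ₁ T₁ t = phase σ₂ T₂ t := by
  set T := min T₁ T₂
  have hT : 0 < T := lt_min h₁.1.1 h₂.1.1
  have htT : t ∈ Icc 0 T := ⟨ht₁.1, le_min ht₁.2 ht₂.2⟩
  have heq := (h₁.restrict hT (min_le_left _ _)).eqOn (h₂.restrict hT (min_le_right _ _))
  rw [← phase_restrict hT (min_le_left _ _) h₁.1.2.1 htT,
    ← phase_restrict hT (min_le_right _ _) h₂.1.2.1 htT, phase, phase,
    mfderivWithin_congr heq (heq htT), heq htT]

/-- Uniqueness removes the dependence of the flow on the geodesic picked by choice. -/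
theorem MPSystem.flow_eq [T2Space M] (h : S.IsGeodesicFrom p σ T) (ht : t ∈ Icc 0 T) :
    S.flow t p = phase σ T t := by
  have hex : ∃ c : (ℝ → M) × ℝ, S.IsGeodesicFrom p c.1 c.2 ∧ t ∈ Icc 0 c.2 := ⟨(σ, T), h, ht⟩
  rw [MPSystem.flow, dif_pos hex]
  exact hex.choose_spec.1.phase_eq h hex.choose_spec.2 ht

end MPRay

/-! ### The time change of a single geodesic. -/

namespace MPRay

open Filter Topology

/-- The inverse of the primitive of a continuous function bounded below by a positive constant. -/
theorem exists_inverse_primitive {q : ℝ → ℝ} (hq : Continuous q) {c : ℝ} (hc : 0 < c)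
    (hcq : ∀ t, c ≤ q t) :
    ∃ θ : ℝ → ℝ, StrictMono θ ∧ (∀ t, θ (∫ r in (0 : ℝ)..t, q r) = t) ∧
      ∀ s, HasDerivAt θ (q (θ s))⁻¹ s := by
  set φ : ℝ → ℝ := fun t => ∫ r in (0 : ℝ)..t, q r with hφ
  have hderiv : ∀ t, HasDerivAt φ (q t) t := fun t => hq.integral_hasStrictDerivAt 0 t |>.hasDerivAt
  have hmono : StrictMono φ := strictMono_of_deriv_pos fun t => by
    rw [(hderiv t).deriv]; exact hc.trans_le (hcq t)
  have hcont : Continuous φ := continuous_iff_continuousAt.2 fun t => (hderiv t).continuousAt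
  -- Comparison with the line `c t` forces `φ → ±∞` at `±∞`, hence surjectivity.
  have hmono' : Monotone fun t => φ t - c * t := by
    refine monotone_of_deriv_nonneg (fun t => ?_) fun t => ?_
    · exact ((hderiv t).sub ((hasDerivAt_id t).const_mul c)).differentiableAt
    · refine le_of_le_of_eq ?_ ((hderiv t).sub ((hasDerivAt_id t).const_mul c)).deriv.symm
      have := hcq t
      linarith
  have h0 : φ 0 = 0 := by simp [hφ]
  have hsurj : Function.Surjective φ := by
    refine hcont.surjective ?_ ?_
    · refine tendsto_atTop_mono' _ ?_ (tendsto_id.const_mul_atTop hc)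
      filter_upwards [eventually_ge_atTop 0] with t ht
      have := hmono' ht
      simp only [h0] at this
      simp only [id]
      linarith
    · refine tendsto_atBot_mono' _ ?_ (tendsto_id.const_mul_atBot hc)
      filter_upwards [eventually_le_atBot 0] with t ht
      have := hmono' ht
      simp only [h0] at this
      simp only [id]
      linarith
  let e := hmono.orderIsoOfSurjective φ hsurj
  refine ⟨e.symm, e.symm.strictMono, fun t => e.symm_apply_apply t, fun s => ?_⟩
  refine HasDerivAt.of_local_left_inverse e.symm.continuous.continuousAt
    (hderiv (e.symm s)) (hc.trans_le (hcq _)).ne' (Eventually.of_forall fun s => ?_)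
  exact e.apply_symm_apply s

/-- A positive continuous function on `[0, T]` extends to a continuous function on the line which
is bounded below by a positive constant. -/
theorem exists_continuous_extension {f : ℝ → ℝ} {T : ℝ} (hT : 0 ≤ T)
    (hf : ContinuousOn f (Icc 0 T)) (hpos : ∀ t ∈ Icc 0 T, 0 < f t) :
    ∃ q : ℝ → ℝ, Continuous q ∧ (∃ c > 0, ∀ t, c ≤ q t) ∧ EqOn q f (Icc 0 T) := by
  have hproj : ∀ t : ℝ, max 0 (min t T) ∈ Icc 0 T := fun t =>
    ⟨le_max_left _ _, max_le hT (min_le_right _ _)⟩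
  refine ⟨fun t => f (max 0 (min t T)), ?_, ?_, fun t ht => ?_⟩
  · exact hf.comp_continuous (by fun_prop) hproj
  · obtain ⟨t₀, ht₀, hmin⟩ := isCompact_Icc.exists_isMinOn (nonempty_Icc.2 hT) hf
    exact ⟨f t₀, hpos t₀ ht₀, fun t => hmin (hproj t)⟩
  · simp only [min_eq_left ht.2, max_eq_right ht.1]

theorem integral_congr_of_eqOn {f q : ℝ → ℝ} {T t : ℝ} (h : EqOn q f (Icc 0 T))
    (ht : t ∈ Icc 0 T) : ∫ r in (0 : ℝ)..t, q r = ∫ r in (0 : ℝ)..t, f r := by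
  refine intervalIntegral.integral_congr fun r hr => h ?_
  rw [uIcc_of_le ht.1] at hr
  exact ⟨hr.1, hr.2.trans ht.2⟩

variable {n : ℕ} [NeZero n] {M : Type*} [TopologicalSpace M]
  [ChartedSpace (EuclideanHalfSpace n) M] [IsManifold (𝓡∂ n) ∞ M]
  {S S' : MPSystem n M} {k k' : ℝ} {P : M → ℝ} {σ : ℝ → M} {T t : ℝ} {x₀ : M} {p : TM n M}

/-- The map `(x, v) ↦ (x, v / P(x))` of the tangent bundle. -/
def rescale (P : M → ℝ) (p : TM n M) : TM n M := ⟨p.1, (P p.1)⁻¹ • p.2⟩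

theorem Conformal.rescale_rescale (h : Conformal S S' k k' P) (p : TM n M) :
    rescale (fun x => (P x)⁻¹) (rescale P p) = p := by
  obtain ⟨x, v⟩ := p
  have hv : (P x)⁻¹⁻¹ • ((P x)⁻¹ • v) = v := by
    rw [inv_inv, smul_smul, mul_inv_cancel₀ (h.pos x).ne', one_smul]
  exact congrArg (fun w => (⟨x, w⟩ : TM n M)) hv

/-- Since `|v/P|²` in the metric `P g` is `|v|²/P`, the kinetic energy `k - U` becomes `(k - U)/P =
k' - U'`. -/
theorem Conformal.energy_rescale (h : Conformal S S' k k' P) (hp : S.energy p = k) :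
    S'.energy (rescale P p) = k' := by
  obtain ⟨x, v⟩ := p
  have h1 := h.potential x
  have h2 := (h.pos x).ne'
  have h3 : S'.g.inner x ((P x)⁻¹ • v) ((P x)⁻¹ • v) = (P x)⁻¹ * S.g.inner x v v := by
    rw [h.inner]
    simp [h2]
  have h4 : 1 / 2 * S.g.inner x v v + S.U x = k := hp
  change 1 / 2 * S'.g.inner x ((P x)⁻¹ • v) ((P x)⁻¹ • v) + S'.U x = k'
  rw [h3]
  field_simp
  linear_combination 2 * h4 - 2 * h1

/-- Maupertuis' principle: an MP-geodesic of energy `k` is a geodesic of the conformally related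
system after the time change `s(t) = ∫₀ᵗ P(σ)`. -/
theorem Conformal.time_change (h : Conformal S S' k k' P) (hσ : S.IsGeodesicFrom p σ T)
    (hp : S.energy p = k) :
    ∃ γ : ℝ → M, S'.IsGeodesicFrom (rescale P p) γ (∫ r in (0 : ℝ)..T, P (σ r)) ∧
      ∀ t ∈ Icc 0 T, phase (n := n) γ (∫ r in (0 : ℝ)..T, P (σ r)) (∫ r in (0 : ℝ)..t, P (σ r))
        = rescale P (phase σ T t) := by
  have hT := hσ.1.1
  have hσ2 := hσ.1.2.1
  -- The factor `P(σ)` is controlled only on `[0, T]`; extending it lets the inverse time change `θ`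
  -- be defined on the whole line.
  obtain ⟨q, hq, ⟨c, hc, hcq⟩, hqσ⟩ := exists_continuous_extension (f := fun r => P (σ r)) hT.le
    (h.contMDiff.continuous.comp_continuousOn hσ2.continuousOn) fun t _ => h.pos _
  obtain ⟨θ, hθmono, hθinv, hθderiv⟩ := exists_inverse_primitive hq hc hcq
  have hint : ∀ t ∈ Icc 0 T, ∫ r in (0 : ℝ)..t, P (σ r) = ∫ r in (0 : ℝ)..t, q r := fun t ht =>
    (integral_congr_of_eqOn hqσ ht).symm
  rw [hint T (right_mem_Icc.2 hT.le)]
  set L := ∫ r in (0 : ℝ)..T, q r with hL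
  have hθL : θ L = T := hθinv T
  have hθ0 : θ 0 = 0 := by simpa using hθinv 0
  have hLpos : 0 < L := hθmono.lt_iff_lt.1 (by rwa [hθL, hθ0])
  have hθmaps : MapsTo θ (Icc 0 L) (Icc 0 T) := fun s hs =>
    ⟨hθ0 ▸ hθmono.monotone hs.1, hθL ▸ hθmono.monotone hs.2⟩
  have hderiv : ∀ s ∈ Icc 0 L, HasDerivWithinAt θ (P (σ (θ s)))⁻¹ (Icc 0 L) s := fun s hs => by
    have := (hθderiv s).hasDerivWithinAt (s := Icc 0 L)
    rwa [hqσ (hθmaps hs)] at this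
  have hud := uniqueDiffOn_Icc hLpos
  have hθ1 : ContDiffOn ℝ 1 θ (Icc 0 L) := by
    refine ContDiff.contDiffOn (contDiff_one_iff_deriv.2
      ⟨fun s => (hθderiv s).differentiableAt, ?_⟩)
    have hθc : Continuous θ := continuous_iff_continuousAt.2 fun s => (hθderiv s).continuousAt
    have : deriv θ = fun s => (q (θ s))⁻¹ := funext fun s => (hθderiv s).deriv
    rw [this]
    exact (hq.comp hθc).inv₀ fun s => (hc.trans_le (hcq _)).ne'
  have hPγ : ContDiffOn ℝ 1 (fun s => (P (σ (θ s)))⁻¹) (Icc 0 L) := by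
    refine ContDiffOn.inv ?_ fun s _ => (h.pos _).ne'
    rw [← contMDiffOn_iff_contDiffOn] at hθ1 ⊢
    exact (h.contMDiff.of_le (m := 1) (by norm_cast)).comp_contMDiffOn
      ((hσ2.of_le (by norm_cast)).comp hθ1 hθmaps)
  -- Bootstrap: `θ` is `C¹`, so `θ' = 1/P(σ ∘ θ)` is `C¹` and `θ` is `C²`. This is claimed only on
  -- `[0, L]`, as the extension `q` is merely continuous.
  have hθ2 : ContDiffOn ℝ 2 θ (Icc 0 L) := by
    rw [show (2 : WithTop ℕ∞) = 1 + 1 by norm_num, contDiffOn_succ_iff_derivWithin hud]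
    refine ⟨fun s hs => (hderiv s hs).differentiableWithinAt, by simp, hPγ.congr fun s hs => ?_⟩
    exact (hderiv s hs).derivWithin (hud s hs)
  have hγ2 : ContMDiffOn 𝓘(ℝ, ℝ) (𝓡∂ n) 2 (σ ∘ θ) (Icc 0 L) :=
    hσ2.comp (contMDiffOn_iff_contDiffOn.2 hθ2) hθmaps
  have h1 : ∀ x₀ : M, ∀ s ∈ Icc 0 L,
      (σ ∘ θ) s ∈ (chartAt (EuclideanHalfSpace n) x₀).source →
      HasDerivWithinAt (coords x₀ (σ ∘ θ)) ((P (σ (θ s)))⁻¹ • velocity (n := n) x₀ σ T (θ s))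
        (Icc 0 L) s := fun x₀ s hs hss =>
    (hasDerivWithinAt_coords hσ2 (hθmaps hs) hss).scomp s (hderiv s hs) hθmaps
  have hgeod : S'.IsGeodesic (σ ∘ θ) L := by
    refine MPSystem.isGeodesic_of_system hLpos hγ2
      (fun x₀ s => (P (σ (θ s)))⁻¹ • velocity (n := n) x₀ σ T (θ s)) h1 fun x₀ s hs hss => ?_
    have hy := coords_mem_target hss
    have hpt : pt x₀ (coords (n := n) x₀ (σ ∘ θ) s) = σ (θ s) := pt_coords hss
    have hdP := ((comp_pt_contDiffWithinAt h.contMDiff hy).differentiableWithinAt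
      (by simp)).hasFDerivWithinAt
    have h2 := hasDerivWithinAt_comp_of_mapsTo hdP (coords_mapsTo_range _) (h1 x₀ s hs hss)
    have h3 : HasDerivWithinAt (fun s => P (σ (θ s)))
        (fderivWithin ℝ (fun z => P (pt x₀ z)) (range (𝓡∂ n)) (coords x₀ (σ ∘ θ) s)
          ((P (σ (θ s)))⁻¹ • velocity x₀ σ T (θ s))) (Icc 0 L) s := by
      refine h2.congr_of_eventuallyEq ?_ (congrArg P hpt).symm
      filter_upwards [source_mem_nhdsWithin (hγ2.continuousOn s hs) hss] with r hr
      exact (congrArg P (pt_coords hr)).symm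
    have h4 := (hσ.1.hasDerivWithinAt_velocity (hθmaps hs) hss).scomp s (hderiv s hs) hθmaps
    -- The product rule for `P⁻¹ σ̇` yields `P⁻² σ̈ - P⁻³ dP(σ̇) σ̇`, the left side of
    -- `Conformal.acceleration_eq`.
    have h5 := (h3.inv (h.pos _).ne').smul h4
    have henergy : 1 / 2 * metricInChart S.g x₀ (coords x₀ (σ ∘ θ) s) (velocity x₀ σ T (θ s))
        (velocity x₀ σ T (θ s)) + S.U (pt x₀ (coords (n := n) x₀ (σ ∘ θ) s)) = k := by
      refine (MPSystem.energy_phase hT hσ2 (hθmaps hs) hss).symm.trans ?_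
      -- Conservation of energy keeps the curve on the level `k`, where the chart identity is valid.
      rw [hσ.1.energy_phase_eq (hθmaps hs), hσ.2, hp]
    have h6 := h.acceleration_eq hy (velocity x₀ σ T (θ s)) _ henergy rfl
    rw [hpt] at h6
    rw [← h6]
    refine h5.congr_deriv ?_
    have hP := (h.pos (σ (θ s))).ne'
    simp only [map_smul, smul_eq_mul, smul_smul, Function.comp_apply, Pi.inv_apply]
    rw [sub_eq_add_neg, ← neg_smul]
    congr 1
    · congr 1
      field_simp
    · congr 1
      field_simp
  have hphase : ∀ t ∈ Icc 0 T, phase (n := n) (σ ∘ θ) L (∫ r in (0 : ℝ)..t, q r)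
      = rescale P (phase σ T t) := by
    intro t ht
    set s := ∫ r in (0 : ℝ)..t, q r
    have hst : θ s = t := hθinv t
    have hs : s ∈ Icc 0 L := ⟨hθmono.le_iff_le.1 (by rw [hst, hθ0]; exact ht.1),
      hθmono.le_iff_le.1 (by rw [hst, hθL]; exact ht.2)⟩
    have hss : (σ ∘ θ) s ∈ (chartAt (EuclideanHalfSpace n) (σ (θ s))).source :=
      mem_chart_source _ _
    have hv : velocity (n := n) (σ (θ s)) (σ ∘ θ) L s = _ := (h1 _ s hs hss).derivWithin (hud s hs)
    rw [phase, mfderivWithin_eq_frame hLpos hγ2 hs hss, hv, map_smul, ← hst, rescale, phase,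
      mfderivWithin_eq_frame hT hσ2 (hθmaps hs) hss]
    rfl
  refine ⟨σ ∘ θ, ⟨hgeod, ?_⟩, fun t ht => by rw [hint t ht]; exact hphase t ht⟩
  have := hphase 0 (left_mem_Icc.2 hT.le)
  rwa [intervalIntegral.integral_same, hσ.2] at this

end MPRay

/-! ### The time change on the whole life interval and the change of variables in ray integrals. -/

namespace MPRay

open Filter Topology

variable {n : ℕ} [NeZero n] {M : Type*} [TopologicalSpace M]
  [ChartedSpace (EuclideanHalfSpace n) M] [IsManifold (𝓡∂ n) ∞ M]
  {S S' : MPSystem n M} {k k' : ℝ} {P : M → ℝ} {σ : ℝ → M} {T t : ℝ} {x₀ : M} {p : TM n M}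

/-- The half-open interval `0 ≤ t < τ(x, v)`. -/
def MPSystem.lifeInterval (S : MPSystem n M) (p : TM n M) : Set ℝ :=
  {t | 0 ≤ t ∧ ENNReal.ofReal t < S.exitTime p}

/-- A time strictly below the supremum lies before the end of some geodesic, so everything on the
half-open interval can be computed along a geodesic that lasts strictly longer. -/
theorem MPSystem.mem_lifeInterval_iff : t ∈ S.lifeInterval p ↔
    0 ≤ t ∧ ∃ (T : ℝ) (σ : ℝ → M), S.IsGeodesicFrom p σ T ∧ t < T := by
  refine and_congr_right fun ht => ?_
  rw [MPSystem.exitTime, lt_sSup_iff]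
  constructor
  · rintro ⟨_, ⟨T, σ, h, rfl⟩, hlt⟩
    exact ⟨T, σ, h, (ENNReal.ofReal_lt_ofReal_iff h.1.1).1 hlt⟩
  · rintro ⟨T, σ, h, hlt⟩
    exact ⟨_, ⟨T, σ, h, rfl⟩, (ENNReal.ofReal_lt_ofReal_iff h.1.1).2 hlt⟩

theorem MPSystem.measurableSet_lifeInterval : MeasurableSet (S.lifeInterval p) :=
  (measurableSet_le measurable_const measurable_id).inter
    (measurableSet_lt ENNReal.measurable_ofReal measurable_const)

/-- The intervals differ at most in the point `τ`, where the flow may have its default value; this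
is a null set. -/
theorem MPSystem.timeInterval_ae_eq : S.timeInterval p =ᵐ[volume] S.lifeInterval p := by
  have hsub : S.lifeInterval p ⊆ S.timeInterval p := fun t ht => ⟨ht.1, ht.2.le⟩
  refine (hsub.eventuallyLE.antisymm ?_).symm
  have hnull : volume (S.timeInterval p \ S.lifeInterval p) = 0 := by
    refine measure_mono_null (t := {(S.exitTime p).toReal}) ?_ (measure_singleton _)
    rintro t ⟨ht, hnot⟩
    have h : ENNReal.ofReal t = S.exitTime p :=
      le_antisymm ht.2 (not_lt.1 fun h => hnot ⟨ht.1, h⟩)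
    rw [mem_singleton_iff, ← h, ENNReal.toReal_ofReal ht.1]
  exact ae_le_set.2 hnull

theorem MPSystem.energy_flow [T2Space M] (ht : t ∈ S.lifeInterval p) :
    S.energy (S.flow t p) = S.energy p := by
  obtain ⟨ht0, T, σ, hσ, htT⟩ := MPSystem.mem_lifeInterval_iff.1 ht
  rw [MPSystem.flow_eq hσ ⟨ht0, htT.le⟩, hσ.1.energy_phase_eq ⟨ht0, htT.le⟩, hσ.2]

/-- The time change `t ↦ ∫₀ᵗ P(σ)` along the trajectory `σ` of `p`. -/
def timeChange (S : MPSystem n M) (P : M → ℝ) (p : TM n M) (t : ℝ) : ℝ :=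
  ∫ r in (0 : ℝ)..t, P (S.flow r p).1

theorem timeChange_eq [T2Space M] (hσ : S.IsGeodesicFrom p σ T) (ht : t ∈ Icc 0 T) :
    timeChange S P p t = ∫ r in (0 : ℝ)..t, P (σ r) := by
  refine integral_congr_of_eqOn (T := T) (fun r hr => ?_) ht
  rw [MPSystem.flow_eq hσ hr]
  rfl

theorem timeChange_eq_of_eqOn [T2Space M] (hσ : S.IsGeodesicFrom p σ T) {q : ℝ → ℝ}
    (hq : EqOn q (fun r => P (σ r)) (Icc 0 T)) (ht : t ∈ Icc 0 T) :
    timeChange S P p t = ∫ r in (0 : ℝ)..t, q r := by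
  rw [timeChange_eq hσ ht, integral_congr_of_eqOn hq ht]

variable [T2Space M]

theorem Conformal.exists_extension (h : Conformal S S' k k' P) (hσ : S.IsGeodesic σ T) :
    ∃ q : ℝ → ℝ, Continuous q ∧ (∃ c > 0, ∀ t, c ≤ q t) ∧
      EqOn q (fun r => P (σ r)) (Icc 0 T) :=
  exists_continuous_extension hσ.1.le
    (h.contMDiff.continuous.comp_continuousOn hσ.2.1.continuousOn) fun _ _ => h.pos _

theorem Conformal.hasDerivWithinAt_timeChange (h : Conformal S S' k k' P)
    (ht : t ∈ S.lifeInterval p) :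
    HasDerivWithinAt (timeChange S P p) (P (S.flow t p).1) (S.lifeInterval p) t := by
  obtain ⟨ht0, T, σ, hσ, htT⟩ := MPSystem.mem_lifeInterval_iff.1 ht
  obtain ⟨q, hq, -, hqσ⟩ := h.exists_extension hσ.1
  have hmem : t ∈ Icc 0 T := ⟨ht0, htT.le⟩
  have hval : P (S.flow t p).1 = q t := by
    rw [MPSystem.flow_eq hσ hmem, hqσ hmem]
    rfl
  rw [hval]
  refine (hq.integral_hasStrictDerivAt 0 t).hasDerivAt.hasDerivWithinAt.congr_of_eventuallyEq ?_
    (timeChange_eq_of_eqOn hσ hqσ hmem)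
  filter_upwards [self_mem_nhdsWithin, mem_nhdsWithin_of_mem_nhds (Iio_mem_nhds htT)] with r hr hrT
  exact timeChange_eq_of_eqOn hσ hqσ ⟨hr.1, le_of_lt hrT⟩

theorem Conformal.strictMonoOn_timeChange (h : Conformal S S' k k' P)
    (hσ : S.IsGeodesicFrom p σ T) :
    StrictMonoOn (timeChange S P p) (Icc 0 T) := by
  obtain ⟨q, hq, ⟨c, hc, hcq⟩, hqσ⟩ := h.exists_extension hσ.1
  have hmono : StrictMono fun t => ∫ r in (0 : ℝ)..t, q r := strictMono_of_deriv_pos fun t => by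
    rw [(hq.integral_hasStrictDerivAt 0 t).hasDerivAt.deriv]
    exact hc.trans_le (hcq t)
  intro a ha b hb hab
  rw [timeChange_eq_of_eqOn hσ hqσ ha, timeChange_eq_of_eqOn hσ hqσ hb]
  exact hmono hab

theorem Conformal.injOn_timeChange (h : Conformal S S' k k' P) :
    InjOn (timeChange S P p) (S.lifeInterval p) := by
  intro a ha b hb hab
  obtain ⟨ha0, T, σ, hσ, haT⟩ := MPSystem.mem_lifeInterval_iff.1 ha
  obtain ⟨hb0, T', σ', hσ', hbT'⟩ := MPSystem.mem_lifeInterval_iff.1 hb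
  rcases le_total a b with hle | hle
  · exact (h.strictMonoOn_timeChange hσ').injOn ⟨ha0, hle.trans hbT'.le⟩ ⟨hb0, hbT'.le⟩ hab
  · exact (h.strictMonoOn_timeChange hσ).injOn ⟨ha0, haT.le⟩ ⟨hb0, hle.trans haT.le⟩ hab

/-- The trajectory of `p` after the time change. -/
theorem Conformal.flow_timeChange (h : Conformal S S' k k' P) (hp : S.energy p = k)
    (ht : t ∈ S.lifeInterval p) :
    timeChange S P p t ∈ S'.lifeInterval (rescale P p) ∧
      S'.flow (timeChange S P p t) (rescale P p) = rescale P (S.flow t p) := by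
  obtain ⟨ht0, T, σ, hσ, htT⟩ := MPSystem.mem_lifeInterval_iff.1 ht
  have hmem : t ∈ Icc 0 T := ⟨ht0, htT.le⟩
  have hTmem : T ∈ Icc 0 T := right_mem_Icc.2 hσ.1.1.le
  have h0mem : (0 : ℝ) ∈ Icc 0 T := left_mem_Icc.2 hσ.1.1.le
  obtain ⟨γ, hγ, hphase⟩ := h.time_change hσ hp
  rw [← timeChange_eq hσ hTmem] at hγ hphase
  have hmono := h.strictMonoOn_timeChange hσ
  have h0 : timeChange S P p 0 = 0 := intervalIntegral.integral_same
  have h1 : 0 ≤ timeChange S P p t := h0 ▸ hmono.monotoneOn h0mem hmem ht0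
  have h2 : timeChange S P p t < timeChange S P p T := hmono hmem hTmem htT
  refine ⟨MPSystem.mem_lifeInterval_iff.2 ⟨h1, _, γ, hγ, h2⟩, ?_⟩
  rw [MPSystem.flow_eq hγ ⟨h1, h2.le⟩, MPSystem.flow_eq hσ hmem, ← hphase t hmem,
    timeChange_eq hσ hmem]

/-- The time changes of conformally related systems are inverse to each other. -/
theorem Conformal.timeChange_timeChange (h : Conformal S S' k k' P) (hp : S.energy p = k)
    {s : ℝ} (hs : s ∈ S'.lifeInterval (rescale P p)) :
    timeChange S' (fun x => (P x)⁻¹) (rescale P p) s ∈ S.lifeInterval p ∧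
    timeChange S P p (timeChange S' (fun x => (P x)⁻¹) (rescale P p) s) = s := by
  have hp' := h.energy_rescale hp
  set p' := rescale P p with hp'def
  have hback : rescale (fun x => (P x)⁻¹) p' = p := h.rescale_rescale p
  have hflow : ∀ r ∈ S'.lifeInterval p', _ := fun r hr => h.symm.flow_timeChange hp' hr
  rw [hback] at hflow
  set ψ := timeChange S' (fun x => (P x)⁻¹) p' with hψ
  obtain ⟨hψs, -⟩ := hflow s hs
  refine ⟨hψs, ?_⟩
  obtain ⟨hs0, L, γ, hγ, hsL⟩ := MPSystem.mem_lifeInterval_iff.1 hs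
  obtain ⟨q', hq', -, hq'γ⟩ := h.symm.exists_extension hγ.1
  obtain ⟨ht0, T, σ, hσ, htT⟩ := MPSystem.mem_lifeInterval_iff.1 hψs
  obtain ⟨q, hq, -, hqσ⟩ := h.exists_extension hσ.1
  have hψq : ∀ r ∈ Icc 0 L, ψ r = ∫ u in (0 : ℝ)..r, q' u := fun r hr =>
    timeChange_eq_of_eqOn hγ hq'γ hr
  rw [timeChange_eq_of_eqOn hσ hqσ ⟨ht0, htT.le⟩, hψq s ⟨hs0, hsL.le⟩]
  -- Here `q'` is the extended factor `1/P(γ)`, the derivative of `ψ`. Substitution gives `∫₀^{ψ(s)}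
  -- P(σ) = ∫₀ˢ P(σ(ψ r)) / P(γ r) dr`, and the integrand is `1` because `σ ∘ ψ = γ`.
  have hsubst := intervalIntegral.integral_comp_mul_deriv (a := 0) (b := s)
    (f := fun r => ∫ u in (0 : ℝ)..r, q' u) (f' := q') (g := q)
    (fun r _ => (hq'.integral_hasStrictDerivAt 0 r).hasDerivAt) hq'.continuousOn hq
  rw [intervalIntegral.integral_same] at hsubst
  rw [← hsubst]
  have hone : ∀ r ∈ uIcc 0 s, (q ∘ fun r => ∫ u in (0 : ℝ)..r, q' u) r * q' r = 1 := by
    intro r hr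
    rw [uIcc_of_le hs0] at hr
    have hrL : r ∈ Icc 0 L := ⟨hr.1, hr.2.trans hsL.le⟩
    have hrlife : r ∈ S'.lifeInterval p' :=
      MPSystem.mem_lifeInterval_iff.2 ⟨hr.1, L, γ, hγ, hr.2.trans_lt hsL⟩
    obtain ⟨hψr, hfl⟩ := hflow r hrlife
    have hψT : ψ r ∈ Icc 0 T := ⟨hψr.1, ((h.symm.strictMonoOn_timeChange hγ).monotoneOn hrL
      ⟨hs0, hsL.le⟩ hr.2).trans htT.le⟩
    rw [MPSystem.flow_eq hσ hψT, MPSystem.flow_eq hγ hrL] at hfl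
    have hpos : σ (ψ r) = γ r := congrArg TotalSpace.proj hfl
    rw [Function.comp_apply, ← hψq r hrL, hqσ hψT, hq'γ hrL]
    simp only [hpos]
    exact mul_inv_cancel₀ (h.pos _).ne'
  rw [intervalIntegral.integral_congr hone]
  simp

theorem Conformal.image_timeChange (h : Conformal S S' k k' P) (hp : S.energy p = k) :
    timeChange S P p '' S.lifeInterval p = S'.lifeInterval (rescale P p) := by
  refine Subset.antisymm ?_ fun s hs => ?_
  · rintro _ ⟨t, ht, rfl⟩
    exact (h.flow_timeChange hp ht).1
  · exact ⟨_, h.timeChange_timeChange hp hs⟩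

section RayIntegral

variable {F F' : TM n M → ℝ}

/-- The relation between `F` and `F'` is assumed only at energy `k`, which the flow preserves. The
absolute value is that of the derivative in the change of variables formula. -/
theorem Conformal.integrand_eq (h : Conformal S S' k k' P) (hp : S.energy p = k)
    (hF : ∀ q, S.energy q = k → F q = P q.1 * F' (rescale P q)) (ht : t ∈ S.lifeInterval p) :
    |P (S.flow t p).1| • F' (S'.flow (timeChange S P p t) (rescale P p)) = F (S.flow t p) := by
  rw [(h.flow_timeChange hp ht).2, hF _ ((MPSystem.energy_flow ht).trans hp),
    abs_of_pos (h.pos _), smul_eq_mul]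

theorem Conformal.converges_iff (h : Conformal S S' k k' P) (hp : S.energy p = k)
    (hF : ∀ q, S.energy q = k → F q = P q.1 * F' (rescale P q)) :
    S.Converges F p ↔ S'.Converges F' (rescale P p) := by
  rw [MPSystem.Converges, MPSystem.Converges, integrableOn_congr_set_ae S.timeInterval_ae_eq,
    integrableOn_congr_set_ae S'.timeInterval_ae_eq, ← h.image_timeChange hp,
    integrableOn_image_iff_integrableOn_abs_deriv_smul MPSystem.measurableSet_lifeInterval
      (fun t ht => h.hasDerivWithinAt_timeChange ht) h.injOn_timeChange]
  exact integrableOn_congr_fun (fun t ht => (h.integrand_eq hp hF ht).symm)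
    MPSystem.measurableSet_lifeInterval

/-- The substitution formula needs no integrability: without absolute convergence both integrals are
`0` by convention. -/
theorem Conformal.rayIntegral_eq (h : Conformal S S' k k' P) (hp : S.energy p = k)
    (hF : ∀ q, S.energy q = k → F q = P q.1 * F' (rescale P q)) :
    S.rayIntegral F p = S'.rayIntegral F' (rescale P p) := by
  rw [MPSystem.rayIntegral, MPSystem.rayIntegral, setIntegral_congr_set S.timeInterval_ae_eq,
    setIntegral_congr_set S'.timeInterval_ae_eq, ← h.image_timeChange hp,
    integral_image_eq_integral_abs_deriv_smul MPSystem.measurableSet_lifeInterval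
      (fun t ht => h.hasDerivWithinAt_timeChange ht) h.injOn_timeChange]
  exact setIntegral_congr_fun MPSystem.measurableSet_lifeInterval
    (fun t ht => (h.integrand_eq hp hF ht).symm)

end RayIntegral

end MPRay

/-! ### Square integrability, the influx boundary and the integrands. -/

namespace MPRay

open Filter Topology ContinuousLinearMap

section TraceBound

variable {V : Type*} [AddCommGroup V] [Module ℝ V] [TopologicalSpace V] [IsTopologicalAddGroup V]
  [ContinuousSMul ℝ V] [FiniteDimensional ℝ V] {g h : V →L[ℝ] V →L[ℝ] ℝ}

theorem sq_trace_inverse_comp_le (hg : g.IsInvertible) (hsymm : ∀ v w, g v w = g w v)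
    (hpos : ∀ v, v ≠ 0 → 0 < g v v) (hh : ∀ v w, h v w = h w v) :
    LinearMap.trace ℝ V (g.inverse.comp h : V →L[ℝ] V).toLinearMap ^ 2 ≤ Module.finrank ℝ V *
      LinearMap.trace ℝ V
        ((g.inverse.comp h).comp (g.inverse.comp h) : V →L[ℝ] V).toLinearMap := by
  let B : LinearMap.BilinForm ℝ V := LinearMap.mk₂ ℝ (fun v w => g v w) (by simp) (by simp)
    (by simp) (by simp)
  have key : ∀ v w, g (g.inverse (h v)) w = h v w := fun v w => by rw [hg.self_apply_inverse]
  refine sq_trace_le B hsymm hpos _ fun v w => ?_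
  change g (g.inverse (h v)) w = g v (g.inverse (h w))
  rw [hsymm v, key, key, hh]

/-- With `A = g⁻¹h` and `d = c/p`, the endomorphism is `A + d·Id`, whose square has trace `tr A² +
2d tr A + N d²`. From `(N d - tr A)² ≥ 0` and `(tr A)² ≤ N tr A²` one gets `2d tr A ≤ N d² + tr A²`.
-/
theorem trace_sq_conformal_le (hg : g.IsInvertible) (hsymm : ∀ v w, g v w = g w v)
    (hpos : ∀ v, v ≠ 0 → 0 < g v v) (hh : ∀ v w, h v w = h w v)
    (hdim : 0 < Module.finrank ℝ V) {p c : ℝ} (hp : p ≠ 0) :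
    LinearMap.trace ℝ V (((p • g).inverse.comp (p • h + c • g)).comp
      ((p • g).inverse.comp (p • h + c • g)) : V →L[ℝ] V).toLinearMap
    ≤ 2 * LinearMap.trace ℝ V
        ((g.inverse.comp h).comp (g.inverse.comp h) : V →L[ℝ] V).toLinearMap
      + 2 * Module.finrank ℝ V * (p⁻¹ * c) ^ 2 := by
  have h1 := sq_trace_inverse_comp_le hg hsymm hpos hh
  set A : V →L[ℝ] V := g.inverse.comp h with hA
  have h2 : (p • g).inverse.comp (p • h + c • g) = A + (p⁻¹ * c) • ContinuousLinearMap.id ℝ V := by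
    rw [inverse_smul_of_isInvertible hg hp]
    ext v
    simp [hA, hg, smul_smul, hp, mul_comm c]
  have h3 : ((A + (p⁻¹ * c) • ContinuousLinearMap.id ℝ V).comp
      (A + (p⁻¹ * c) • ContinuousLinearMap.id ℝ V) : V →L[ℝ] V).toLinearMap
      = (A.comp A : V →L[ℝ] V).toLinearMap + (2 * (p⁻¹ * c)) • A.toLinearMap
        + ((p⁻¹ * c) ^ 2) • LinearMap.id := by
    ext v
    simp [smul_smul, two_mul, add_smul, pow_two]
    abel
  rw [h2, h3, map_add, map_add, map_smul, map_smul, LinearMap.trace_id, smul_eq_mul, smul_eq_mul]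
  have hn : (0 : ℝ) < Module.finrank ℝ V := by exact_mod_cast hdim
  generalize LinearMap.trace ℝ V (A.comp A : V →L[ℝ] V).toLinearMap = a at *
  generalize LinearMap.trace ℝ V A.toLinearMap = τ at *
  generalize p⁻¹ * c = d at *
  generalize (Module.finrank ℝ V : ℝ) = N at *
  have h4 : N * (2 * d * τ) ≤ N * (N * d ^ 2 + a) := by nlinarith [sq_nonneg (N * d - τ)]
  have h5 := le_of_mul_le_mul_left h4 hn
  nlinarith

end TraceBound

variable {n : ℕ} [NeZero n] {M : Type*} [TopologicalSpace M]
  [ChartedSpace (EuclideanHalfSpace n) M] [IsManifold (𝓡∂ n) ∞ M]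
  {S S' : MPSystem n M} {k k' : ℝ} {P : M → ℝ} {g G : Metric n M}

instance finiteDimensional_tangentSpace (x : M) : FiniteDimensional ℝ (TSp n x) :=
  inferInstanceAs (FiniteDimensional ℝ (E n))

theorem finrank_tangentSpace (x : M) : Module.finrank ℝ (TSp n x) = n :=
  finrank_euclideanSpace_fin (𝕜 := ℝ)

theorem normSqOne_nonneg (g : Metric n M) (x : M) (β : TSp n x →L[ℝ] ℝ) :
    0 ≤ normSqOne g x β := by
  obtain ⟨w, rfl⟩ := (metric_isInvertible g x).surjective β
  rw [normSqOne, (metric_isInvertible g x).inverse_apply_self]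
  by_cases hw : w = 0
  · rw [hw]; simp
  · exact (g.pos x w hw).le

theorem normSqTwo_nonneg (g : Metric n M) (x : M) (h : TSp n x →L[ℝ] TSp n x →L[ℝ] ℝ)
    (hh : ∀ u w, h u w = h w u) : 0 ≤ normSqTwo g x h := by
  have h1 := sq_trace_inverse_comp_le (metric_isInvertible g x) (g.symm x) (g.pos x) hh
  rw [finrank_tangentSpace] at h1
  have hn : (0 : ℝ) < n := by exact_mod_cast Nat.pos_of_ne_zero (NeZero.ne n)
  exact nonneg_of_mul_nonneg_right ((sq_nonneg _).trans h1) hn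

theorem normSqOne_conformal (hG : ∀ x, G.inner x = P x • g.inner x) {x : M} (hP : P x ≠ 0)
    (β : TSp n x →L[ℝ] ℝ) : normSqOne G x β = (P x)⁻¹ * normSqOne g x β := by
  rw [normSqOne, normSqOne, hG, inverse_smul_of_isInvertible (metric_isInvertible g x) hP]
  simp

theorem normSqTwo_conformal_le (hG : ∀ x, G.inner x = P x • g.inner x) {x : M} (hP : P x ≠ 0)
    (h : TSp n x →L[ℝ] TSp n x →L[ℝ] ℝ) (hh : ∀ u w, h u w = h w u) (c : ℝ) :
    normSqTwo G x (P x • h + c • g.inner x)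
      ≤ 2 * normSqTwo g x h + 2 * n * ((P x)⁻¹ * c) ^ 2 := by
  have h1 := trace_sq_conformal_le (c := c) (metric_isInvertible g x) (g.symm x) (g.pos x) hh
    (by rw [finrank_tangentSpace]; exact Nat.pos_of_ne_zero (NeZero.ne n)) hP
  rw [finrank_tangentSpace] at h1
  rw [normSqTwo, hG]
  exact h1

/-! ### The influx boundary -/

/-- The unit normal scales by `P^(-1/2)`, so the product of `v/P` with it in the new metric is
`P^(-1/2) (v, ν)_g`, of unchanged sign. -/
theorem Conformal.rescale_mem_influx (h : Conformal S S' k k' P) {p : TM n M}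
    (hp : p ∈ S.influx k) : rescale P p ∈ S'.influx k' := by
  obtain ⟨henergy, hbd, hinner⟩ := hp
  refine ⟨h.energy_rescale henergy, hbd, ?_⟩
  obtain ⟨x, v⟩ := p
  have hP := h.pos x
  change 0 ≤ S.g.inner x v (inwardUnitNormal S.g x) at hinner
  change 0 ≤ S'.g.inner x ((P x)⁻¹ • v) (inwardUnitNormal S'.g x)
  have hN : inwardNormalVector S'.g x = (P x)⁻¹ • inwardNormalVector S.g x := by
    rw [inwardNormalVector, inwardNormalVector, h.inner,
      inverse_smul_of_isInvertible (metric_isInvertible S.g x) hP.ne']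
    rfl
  rw [inwardUnitNormal] at hinner ⊢
  rw [hN, h.inner]
  simp only [map_smul, _root_.smul_apply, smul_eq_mul] at hinner ⊢
  have h1 : ∀ b : ℝ, (P x)⁻¹ * ((P x)⁻¹ * (P x * b)) = (P x)⁻¹ * b := fun b => by
    rw [inv_mul_cancel_left₀ hP.ne']
  rw [h1, h1, Real.sqrt_mul (inv_nonneg.2 hP.le), mul_inv, mul_mul_mul_comm]
  positivity

/-! ### Volume measures of conformal metrics -/

section Volume

variable [MeasurableSpace M] [BorelSpace M]

theorem measurableSet_target (x₀ : M) : MeasurableSet (extChartAt (𝓡∂ n) x₀).target := by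
  rw [extChartAt_target]
  exact (((chartAt (EuclideanHalfSpace n) x₀).open_target.preimage
    (𝓡∂ n).continuous_symm).measurableSet).inter (𝓡∂ n).isClosed_range.measurableSet

/-- The pushforward of a measure along a map that is not a.e. measurable is zero by convention; here
the chart inverse is continuous on the measurable target, so the local volumes are genuine. -/
theorem aemeasurable_pt (x₀ : M) (d : E n → ℝ≥0∞) : AEMeasurable (pt x₀)
    ((volume.restrict (extChartAt (𝓡∂ n) x₀).target).withDensity d) :=
  ((contMDiffOn_pt x₀).continuousOn.aemeasurable (measurableSet_target x₀)).mono_ac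
    (withDensity_absolutelyContinuous _ _)

/-- In each chart `√det(P g) = P^(n/2) √det g`. A one-sided bound is enough to transfer null sets
and finiteness, and it passes to the supremum over charts. -/
theorem volumeMeasure_conformal_le (hG : ∀ x, G.inner x = P x • g.inner x) (hP : ∀ x, 0 < P x)
    {C : ℝ} (hC : ∀ x, P x ≤ C) :
    volumeMeasure G ≤ ENNReal.ofReal (Real.sqrt (C ^ n)) • volumeMeasure g := by
  refine iSup_le fun x₀ => ?_
  refine le_trans ?_ (smul_le_smul_left _ (le_iSup _ x₀))
  rw [← Measure.map_smul, ← withDensity_smul' _ _ ENNReal.ofReal_ne_top]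
  have hdensity : ∀ y : E n, ENNReal.ofReal (Real.sqrt (Matrix.det (Matrix.of fun i j : Fin n =>
      metricInChart G x₀ y (EuclideanSpace.single i 1) (EuclideanSpace.single j 1))))
      ≤ ENNReal.ofReal (Real.sqrt (C ^ n)) * ENNReal.ofReal (Real.sqrt (Matrix.det
        (Matrix.of fun i j : Fin n =>
          metricInChart g x₀ y (EuclideanSpace.single i 1) (EuclideanSpace.single j 1)))) := by
    intro y
    have hmat : (Matrix.of fun i j : Fin n =>
        metricInChart G x₀ y (EuclideanSpace.single i 1) (EuclideanSpace.single j 1))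
        = P (pt x₀ y) • Matrix.of fun i j : Fin n =>
          metricInChart g x₀ y (EuclideanSpace.single i 1) (EuclideanSpace.single j 1) := by
      ext i j
      simp [metricInChart_apply, hG]
    have hPy := hP (pt x₀ y)
    rw [hmat, Matrix.det_smul, Fintype.card_fin, Real.sqrt_mul (pow_nonneg hPy.le n),
      ENNReal.ofReal_mul (Real.sqrt_nonneg _)]
    gcongr
    exact hC _
  refine Measure.le_iff.2 fun s hs => ?_
  rw [Measure.map_apply_of_aemeasurable (aemeasurable_pt x₀ _) hs,
    Measure.map_apply_of_aemeasurable (aemeasurable_pt x₀ _) hs]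
  exact withDensity_mono (Eventually.of_forall hdensity) _

theorem Conformal.memL2 [CompactSpace M] (h : Conformal S S' k k' P) (f : Triple n M)
    (f' : Pair n M) (hf : f.MemL2 S.g) (hh : ∀ x, f'.h x = P x • f.h x + f.V x • S.g.inner x)
    (hβ : f'.β = f.β) : f'.MemL2 S'.g := by
  obtain ⟨hfh, hfβ, hfV, hfin⟩ := hf
  have hPc : Continuous P := h.contMDiff.continuous
  obtain ⟨C₁, hC₁⟩ := isCompact_univ.exists_bound_of_continuousOn hPc.continuousOn
  obtain ⟨C₂, hC₂⟩ := isCompact_univ.exists_bound_of_continuousOn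
    (hPc.inv₀ fun x => (h.pos x).ne').continuousOn
  have hC₁' : ∀ x, P x ≤ C₁ := fun x => (le_abs_self _).trans (hC₁ x (mem_univ x))
  have hC₂' : ∀ x, (P x)⁻¹ ≤ C₂ := fun x => (le_abs_self _).trans (hC₂ x (mem_univ x))
  have hvol := volumeMeasure_conformal_le h.inner h.pos hC₁'
  have hac : volumeMeasure S'.g ≪ volumeMeasure S.g :=
    (Measure.absolutelyContinuous_of_le hvol).trans
      (Measure.smul_absolutelyContinuous)
  refine ⟨fun x₀ u w => ?_, fun x₀ u => ?_, ?_⟩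
  · refine AEMeasurable.mono_ac ?_ (hac.restrict _)
    have hopen := (chartAt (EuclideanHalfSpace n) x₀).open_source.measurableSet
    have h1 := (hPc.measurable.aemeasurable.mul (hfh x₀ u w)).add ((hfV.restrict).mul
      ((metric_frame_contMDiffOn S.g x₀ u w).continuousOn.aemeasurable hopen))
    refine h1.congr (Eventually.of_forall fun x => ?_)
    simp [hh]
  · rw [hβ]
    exact (hfβ x₀ u).mono_ac (hac.restrict _)
  -- The three summands are the factors for `|h|²`, `|β|²` and `V²`. The absolute value is needed
  -- because on an empty `M` the bound `C₂` may be negative.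
  · set K : ℝ := 2 + |C₂| + 2 * n * C₂ ^ 2 with hK
    have hK0 : 0 ≤ K := by positivity
    have hbound : ∀ x, normSqTwo S'.g x (f'.h x) + normSqOne S'.g x (f'.β x)
        ≤ K * (normSqTwo S.g x (f.h x) + normSqOne S.g x (f.β x) + f.V x ^ 2) := by
      intro x
      have hP := h.pos x
      rw [hh, hβ, normSqOne_conformal h.inner hP.ne']
      have h1 := normSqTwo_conformal_le h.inner hP.ne' (f.h x) (f.h_symm x) (f.V x)
      have h2 := normSqTwo_nonneg S.g x (f.h x) (f.h_symm x)
      have h3 := normSqOne_nonneg S.g x (f.β x)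
      generalize normSqTwo S.g x (f.h x) = a at *
      generalize normSqOne S.g x (f.β x) = b at *
      have hinv : 0 < (P x)⁻¹ := inv_pos.2 hP
      have hle := hC₂' x
      have h4 : ((P x)⁻¹ * f.V x) ^ 2 ≤ C₂ ^ 2 * f.V x ^ 2 := by
        rw [mul_pow]
        gcongr
      have h5 : (P x)⁻¹ * b ≤ |C₂| * b :=
        mul_le_mul_of_nonneg_right (hle.trans (le_abs_self _)) h3
      have h6 : 2 * (n : ℝ) * ((P x)⁻¹ * f.V x) ^ 2 ≤ 2 * n * (C₂ ^ 2 * f.V x ^ 2) :=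
        mul_le_mul_of_nonneg_left h4 (by positivity)
      have h7 : 0 ≤ (|C₂| + 2 * n * C₂ ^ 2) * a := by positivity
      have h8 : 0 ≤ (2 + 2 * n * C₂ ^ 2) * b := by positivity
      have h9 : 0 ≤ (2 + |C₂|) * f.V x ^ 2 := by positivity
      rw [hK]
      linarith
    calc ∫⁻ x, ENNReal.ofReal (normSqTwo S'.g x (f'.h x) + normSqOne S'.g x (f'.β x))
          ∂(volumeMeasure S'.g)
        ≤ ∫⁻ x, ENNReal.ofReal K * ENNReal.ofReal (normSqTwo S.g x (f.h x)
            + normSqOne S.g x (f.β x) + f.V x ^ 2)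
          ∂(ENNReal.ofReal (Real.sqrt (C₁ ^ n)) • volumeMeasure S.g) := by
          refine lintegral_mono' hvol fun x => ?_
          rw [← ENNReal.ofReal_mul hK0]
          exact ENNReal.ofReal_le_ofReal (hbound x)
      _ < ⊤ := by
          rw [lintegral_smul_measure, lintegral_const_mul' _ _ ENNReal.ofReal_ne_top, smul_eq_mul]
          exact ENNReal.mul_lt_top ENNReal.ofReal_lt_top
            (ENNReal.mul_lt_top ENNReal.ofReal_lt_top hfin)

end Volume

/-- On the level `k` one has `|v|_g² = 2(k - U)`, so the function `V` can be absorbed as the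
quadratic form `V g` evaluated at the rescaled velocity. This is the origin of the term `g V` in
`Φ`. -/
theorem MPSystem.poly_eq_rescale (S : MPSystem n M) (hk : ∀ x, S.U x < k) (f : Triple n M)
    (q : TM n M) (hq : S.energy q = k) :
    f.poly q = 2 * (k - S.U q.1) * (S.Phi k f).poly (rescale (fun x => 2 * (k - S.U x)) q) := by
  obtain ⟨x, v⟩ := q
  have hP : 2 * (k - S.U x) ≠ 0 := by have := hk x; linarith
  have h1 : 1 / 2 * S.g.inner x v v + S.U x = k := hq
  set c := 2 * (k - S.U x) with hc
  have h2 : S.g.inner x v v = c := by rw [hc]; linarith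
  change f.h x v v + f.β x v + f.V x = c * (((c • f.h x + f.V x • S.g.inner x) (c⁻¹ • v) (c⁻¹ • v))
    + f.β x (c⁻¹ • v))
  simp only [map_smul, _root_.smul_apply, _root_.add_apply, smul_eq_mul, h2]
  field_simp
  ring

end MPRay

end

theorem mainTheorem7 {n : ℕ} [NeZero n] {M : Type*} [TopologicalSpace M] [T2Space M]
    [CompactSpace M] [ChartedSpace (EuclideanHalfSpace n) M] [IsManifold (𝓡∂ n) ∞ M]
    [MeasurableSpace M] [BorelSpace M]
    (S : MPRay.MPSystem n M) (k : ℝ) (hk : ∀ x, S.U x < k)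
    (f : MPRay.Triple n M) (hf : f.MemL2 S.g) :
    (S.Phi k f).MemL2 (S.reduced k hk).G ∧
    ∀ (x : M) (v : MPRay.TSp n x), (⟨x, v⟩ : MPRay.TM n M) ∈ S.influx k →
      (⟨x, (2 * (k - S.U x))⁻¹ • v⟩ : MPRay.TM n M) ∈ (S.reduced k hk).influx ∧
      (S.Converges f.poly ⟨x, v⟩ ↔
        (S.reduced k hk).toMPSystem.Converges (S.Phi k f).poly
          ⟨x, (2 * (k - S.U x))⁻¹ • v⟩) ∧
      S.rayTransform f ⟨x, v⟩ =
        (S.reduced k hk).rayTransform (S.Phi k f) ⟨x, (2 * (k - S.U x))⁻¹ • v⟩ := by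
  have h := S.conformal_reduced hk
  refine ⟨h.memL2 f (S.Phi k f) hf (fun x => rfl) rfl, fun x v hv => ?_⟩
  have hr : (⟨x, (2 * (k - S.U x))⁻¹ • v⟩ : MPRay.TM n M)
      = MPRay.rescale (fun x => 2 * (k - S.U x)) ⟨x, v⟩ := rfl
  rw [hr]
  exact ⟨h.rescale_mem_influx hv, h.converges_iff hv.1 (S.poly_eq_rescale hk f),
    h.rayIntegral_eq hv.1 (S.poly_eq_rescale hk f)⟩
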